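/- **Proposition 3.3.** Let $G$ be a Lie group (real, finite-dimensional) with Lie algebra $\mathfrak g=T_eG$, let $\pi:P\to M$ be a smooth principal $G$-bundle (finite-dimensional manifolds, right action $(p,g)\mapsto pg=R_g(p)$), let $V$ be a finite-dimensional complex Hilbert space and let $T:G\to \mathrm{Aut}(V)$ be a faithful (smooth) unitary representation with derivative $DT(e):\mathfrak g\to\mathcal B(V)$ at $e$. Let $\vartheta$ be a $DT(e)(\mathfrak g)$-valued connection form on $P$, that is, a smooth one-form with values in $DT(e)(\mathfrak g)$ such that $\vartheta_p\big(\tfrac{d}{dt}\,p\exp(ta)|_{t=0}\big)=DT(e)(a)$ for $a\in\mathfrak g$ and $R_g^*\vartheta=T(g^{-1})\,\vartheta\, T(g)$ for $g\in G$. Write $T_pP=\ker\vartheta_p\oplus\ker D\pi(p)$ for the decomposition into horizontal and vertical parts, $\xi=\xi^h+\xi^v$, with horizontal projection $pr_{hor}$; let $\mathbf DF(\xi)=dF(pr_{hor}\xi)$ be the covariant differential of a function $F$ and $\Omega(\xi,\eta)=d\vartheta(pr_{hor}\xi,pr_{hor}\eta)$ the curvature form, with the Kobayashi–Nomizu conventions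 $2\,d\vartheta(\xi,\eta)=\xi(\vartheta(\eta))-\eta(\vartheta(\xi))-\vartheta([\xi,\eta])$ and $(\xi\llcorner\Omega)(\eta)=2\Omega(\xi,\eta)$. Let * $C^\infty_G(P,DT(e)(\mathfrak g))$ be the space of smooth functions $F:P\to DT(e)(\mathfrak g)$ with $F(pg)=T(g^{-1})F(p)T(g)$; for such $F$ let $F^*$ be the vertical vector field $F^*(p)=\frac{d}{dt}\,p\exp(tF'(p))|_{t=0}$, where $F'(p)\in\mathfrak g$, $DT(e)(F'(p))=F(p)$; * $\mathcal E_G^0$ be the set of smooth vector fields $\xi$ on $P$ with $\xi(pg)=DR_g(p)\xi(p)$ and $\mathcal L_\xi\vartheta=0$; * $\mathcal H_G^0=D\pi(\mathcal E_G^0)$, a set of smooth vector fields on $M$; for a vector field $X$ on $M$ let $X^*$ be its horizontal lift to $P$; * $\mathcal N_G=\{F\in C^\infty_G(P,DT(e)(\mathfrak g)) : \mathbf DF=0\}$; * $\mathcal F_G^0$ be the set of pairs $(F,X)\in C^\infty_G(P,DT(e)(\mathfrak g))\times\mathcal H_G^0$ with $X^*\llcorner\Omega=\mathbf DF$. Then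 $\mathcal E_G^0$ and $\mathcal H_G^0$ are Lie subalgebras of the real Lie algebras of smooth vector fields on $P$ and $M$, $\mathcal N_G$ is a real Lie algebra under the pointwise commutator, and $\mathcal F_G^0$ is a real Lie algebra under the componentwise vector space structure and the bracket $$\{\!\!\{(F,X),(G,Y)\}\!\!\}=(-2\Omega(X^*,Y^*)+[F,G],\,[X,Y]).$$ The assignments $$\mathcal E_G^0\ni\xi\mapsto(-\vartheta(\xi^v),\,D\pi(\xi^h))\in\mathcal F_G^0,\qquad \mathcal F_G^0\ni(F,X)\mapsto X^*-F^*\in\mathcal E_G^0$$ are well defined, mutually inverse isomorphisms of Lie algebras. Moreover $$0\to\mathcal N_G\xrightarrow{\ \iota_1\ }\mathcal F_G^0\xrightarrow{\ pr_2\ }\mathcal H_G^0\to0,\qquad \iota_1(F)=(F,0),\quad pr_2(F,X)=X,$$ is an exact sequence of Lie algebras. -/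

import Mathlib

open Bundle (TotalSpace Trivialization)
open VectorField
open scoped Manifold ContDiff RightActions

noncomputable section

/-! ### The Lie algebra of smooth vector fields -/

/-- `C^∞(N, TN)`: smooth vector fields on a manifold `N` modelled on `E`. -/
abbrev SmoothVF (E : Type*) [NormedAddCommGroup E] [NormedSpace ℝ E]
    (N : Type*) [TopologicalSpace N] [ChartedSpace E N] [IsManifold 𝓘(ℝ, E) ∞ N] : Type _ :=
  Cₛ^∞⟮𝓘(ℝ, E); E, (TangentSpace 𝓘(ℝ, E) : N → Type _)⟯

section VectorFields

variable {E : Type*} [NormedAddCommGroup E] [NormedSpace ℝ E] [FiniteDimensional ℝ E]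
  {N : Type*} [TopologicalSpace N] [ChartedSpace E N] [IsManifold 𝓘(ℝ, E) ∞ N]

theorem smoothVF_mlieBracket_smooth (X Y : SmoothVF E N) :
    ContMDiff 𝓘(ℝ, E) (𝓘(ℝ, E).prod 𝓘(ℝ, E)) ∞
      (fun x => TotalSpace.mk' E x (mlieBracket 𝓘(ℝ, E) X Y x)) := by
  have : CompleteSpace E := FiniteDimensional.complete ℝ E
  have : IsManifold 𝓘(ℝ, E) (((⊤ : ℕ∞) : ℕ∞ω) + 1) N := by
    simpa using (inferInstance : IsManifold 𝓘(ℝ, E) ∞ N)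
  have : IsManifold 𝓘(ℝ, E) (minSmoothness ℝ 2) N := by
    simpa using (inferInstance : IsManifold 𝓘(ℝ, E) 2 N)
  exact ContDiff.mlieBracket_vectorField (m := ⊤) (n := ⊤) X.contMDiff Y.contMDiff (by simp)

/-- The commutator `[X, Y]` of smooth vector fields. -/
instance : Bracket (SmoothVF E N) (SmoothVF E N) where
  bracket X Y := ⟨mlieBracket 𝓘(ℝ, E) X Y, smoothVF_mlieBracket_smooth X Y⟩

theorem smoothVF_lie_apply (X Y : SmoothVF E N) (x : N) :
    ⁅X, Y⁆ x = mlieBracket 𝓘(ℝ, E) X Y x := rfl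

instance : LieRing (SmoothVF E N) where
  add_lie X Y Z := by
    have : CompleteSpace E := FiniteDimensional.complete ℝ E
    ext x
    simp only [smoothVF_lie_apply, ContMDiffSection.coe_add, Pi.add_apply]
    exact mlieBracket_add_left X.mdifferentiableAt Y.mdifferentiableAt
  lie_add X Y Z := by
    have : CompleteSpace E := FiniteDimensional.complete ℝ E
    ext x
    simp only [smoothVF_lie_apply, ContMDiffSection.coe_add, Pi.add_apply]
    exact mlieBracket_add_right Y.mdifferentiableAt Z.mdifferentiableAt
  lie_self X := by
    ext x
    simp [smoothVF_lie_apply]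
  leibniz_lie X Y Z := by
    have : CompleteSpace E := FiniteDimensional.complete ℝ E
    have : IsManifold 𝓘(ℝ, E) (minSmoothness ℝ 3) N := by
      simpa using (inferInstance : IsManifold 𝓘(ℝ, E) 3 N)
    have h : ∀ W : SmoothVF E N, ContMDiff 𝓘(ℝ, E) (𝓘(ℝ, E).prod 𝓘(ℝ, E)) (minSmoothness ℝ 2)
        (fun x => TotalSpace.mk' E x (W x)) := fun W =>
      W.contMDiff.of_le (by simp; exact WithTop.coe_le_coe.2 le_top)
    ext x
    exact leibniz_identity_mlieBracket_apply (h X x) (h Y x) (h Z x)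

instance : LieAlgebra ℝ (SmoothVF E N) where
  lie_smul c X Y := by
    have : CompleteSpace E := FiniteDimensional.complete ℝ E
    ext x
    exact mlieBracket_const_smul_right Y.mdifferentiableAt

end VectorFields

/-! ### Differential calculus of vector-valued one-forms

A `W`-valued one-form on `P` is a family `α p : T_p P →L[ℝ] W`. The conventions for exterior
derivative and interior product are those of Kobayashi and Nomizu:
`2 dα(ξ, η) = ξ(α(η)) - η(α(ξ)) - α([ξ, η])`, and `(ξ ⌟ Ω)(η) = 2 Ω(ξ, η)` for a two-form `Ω`. -/

section Forms

variable {E : Type*} [NormedAddCommGroup E] [NormedSpace ℝ E]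
  {P : Type*} [TopologicalSpace P] [ChartedSpace E P]
  {W : Type*} [NormedAddCommGroup W] [NormedSpace ℝ W]

/-- Smoothness of a one-form, as a function `TP → W` which is linear on the fibres. -/
def SmoothOneForm [IsManifold 𝓘(ℝ, E) ∞ P]
    (α : ∀ p : P, TangentSpace 𝓘(ℝ, E) p →L[ℝ] W) : Prop :=
  ContMDiff 𝓘(ℝ, E).tangent 𝓘(ℝ, W) ∞ (fun u : TangentBundle 𝓘(ℝ, E) P => α u.1 u.2)

/-- `½ (ξ(α(η)) - η(α(ξ)) - α([ξ, η]))` at `p`. -/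
def extDOnFields (α : ∀ p : P, TangentSpace 𝓘(ℝ, E) p →L[ℝ] W)
    (ξ η : ∀ p : P, TangentSpace 𝓘(ℝ, E) p) (p : P) : W :=
  (1 / 2 : ℝ) • (mvfderiv 𝓘(ℝ, E) (fun q => α q (η q)) p (ξ p)
    - mvfderiv 𝓘(ℝ, E) (fun q => α q (ξ q)) p (η p) - α p (mlieBracket 𝓘(ℝ, E) ξ η p))

/-- `(ℒ_ξ α)(η) = ξ(α(η)) - α([ξ, η])` at `p`. -/
def lieDOnFields (ξ : ∀ p : P, TangentSpace 𝓘(ℝ, E) p)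
    (α : ∀ p : P, TangentSpace 𝓘(ℝ, E) p →L[ℝ] W)
    (η : ∀ p : P, TangentSpace 𝓘(ℝ, E) p) (p : P) : W :=
  mvfderiv 𝓘(ℝ, E) (fun q => α q (η q)) p (ξ p) - α p (mlieBracket 𝓘(ℝ, E) ξ η p)

theorem extDOnFields_eq (α : ∀ p : P, TangentSpace 𝓘(ℝ, E) p →L[ℝ] W)
    (ξ η : ∀ p : P, TangentSpace 𝓘(ℝ, E) p) (p : P) :
    extDOnFields α ξ η p = (1 / 2 : ℝ) •
      (lieDOnFields ξ α η p - mvfderiv 𝓘(ℝ, E) (fun q => α q (ξ q)) p (η p)) := by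
  simp only [extDOnFields, lieDOnFields]
  module

theorem extDOnFields_swap (α : ∀ p : P, TangentSpace 𝓘(ℝ, E) p →L[ℝ] W)
    (ξ η : ∀ p : P, TangentSpace 𝓘(ℝ, E) p) (p : P) :
    extDOnFields α ξ η p = - extDOnFields α η ξ p := by
  simp only [extDOnFields]
  rw [mlieBracket_swap_apply, map_neg]
  module

variable [IsManifold 𝓘(ℝ, E) ∞ P]

/-- The exterior derivative `dα` at `p`, evaluated on the tangent vectors `u`, `v`: the invariant
formula applied to vector fields, smooth near `p`, with values `u`, `v` at `p`. It does not depend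
on the choice of these fields, see `extD_apply`. -/
def extD (α : ∀ p : P, TangentSpace 𝓘(ℝ, E) p →L[ℝ] W) (p : P)
    (u v : TangentSpace 𝓘(ℝ, E) p) : W :=
  extDOnFields α (FiberBundle.extend E u) (FiberBundle.extend E v) p

/-- The Lie derivative `ℒ_ξ α` at `p`, evaluated on the tangent vector `v`: the invariant formula
applied to a vector field, smooth near `p`, with value `v` at `p`. It does not depend on the choice
of this field, see `lieD_apply`. -/
def lieD (ξ : ∀ p : P, TangentSpace 𝓘(ℝ, E) p)
    (α : ∀ p : P, TangentSpace 𝓘(ℝ, E) p →L[ℝ] W) (p : P)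
    (v : TangentSpace 𝓘(ℝ, E) p) : W :=
  lieDOnFields ξ α (FiberBundle.extend E v) p

/-- The interior product of a tangent vector `u` with a two-form `Ω`: `(u ⌟ Ω)(v) = 2 Ω(u, v)`. -/
def interiorProd (Ω : ∀ p : P, TangentSpace 𝓘(ℝ, E) p → TangentSpace 𝓘(ℝ, E) p → W) (p : P)
    (u v : TangentSpace 𝓘(ℝ, E) p) : W :=
  (2 : ℝ) • Ω p u v

theorem SmoothOneForm.mdifferentiableAt {α : ∀ p : P, TangentSpace 𝓘(ℝ, E) p →L[ℝ] W}
    (hα : SmoothOneForm α) {η : ∀ p : P, TangentSpace 𝓘(ℝ, E) p} {p : P}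
    (hη : MDiffAt (T% η) p) : MDifferentiableAt 𝓘(ℝ, E) 𝓘(ℝ, W) (fun q => α q (η q)) p :=
  (ContMDiff.mdifferentiable hα (by simp) (TotalSpace.mk' E p (η p))).comp p hη

variable [FiniteDimensional ℝ E]

theorem lieD_tensorial {α : ∀ p : P, TangentSpace 𝓘(ℝ, E) p →L[ℝ] W}
    (hα : SmoothOneForm α) {ξ : ∀ p : P, TangentSpace 𝓘(ℝ, E) p} {p : P} :
    TensorialAt 𝓘(ℝ, E) E (fun η => lieDOnFields ξ α η p) p where
  smul {f η} hf hη := by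
    have : CompleteSpace E := FiniteDimensional.complete ℝ E
    have h := mvfderiv_fun_smul hf (hα.mdifferentiableAt hη)
    have e : (fun q => α q ((f • η) q)) = fun q => f q • α q (η q) := by
      ext1 q; simp
    simp only [lieDOnFields, e, h, mlieBracket_smul_right hf hη]
    simp
    module
  add {η η'} hη hη' := by
    have : CompleteSpace E := FiniteDimensional.complete ℝ E
    have h := mvfderiv_fun_add (hα.mdifferentiableAt hη) (hα.mdifferentiableAt hη')
    have e : (fun q => α q ((η + η') q)) = fun q => α q (η q) + α q (η' q) := by
      ext1 q; simp
    simp only [lieDOnFields, e, h, mlieBracket_add_right hη hη']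
    simp
    module

/-- `(ℒ_ξ α)(η) = ξ(α(η)) - α([ξ, η])` for every vector field `η` differentiable at `p`. -/
theorem lieD_apply {α : ∀ p : P, TangentSpace 𝓘(ℝ, E) p →L[ℝ] W}
    (hα : SmoothOneForm α) (ξ : ∀ p : P, TangentSpace 𝓘(ℝ, E) p) {p : P}
    {η : ∀ p : P, TangentSpace 𝓘(ℝ, E) p} (hη : MDiffAt (T% η) p) :
    lieD ξ α p (η p) = mvfderiv 𝓘(ℝ, E) (fun q => α q (η q)) p (ξ p)
      - α p (mlieBracket 𝓘(ℝ, E) ξ η p) :=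
  (lieD_tensorial hα).pointwise (FiberBundle.mdifferentiableAt_extend ..) hη (by simp)

theorem extD_tensorial {α : ∀ p : P, TangentSpace 𝓘(ℝ, E) p →L[ℝ] W}
    (hα : SmoothOneForm α) {ξ : ∀ p : P, TangentSpace 𝓘(ℝ, E) p} {p : P} :
    TensorialAt 𝓘(ℝ, E) E (fun η => extDOnFields α ξ η p) p where
  smul {f η} hf hη := by
    simp only [extDOnFields_eq, (lieD_tensorial hα).smul hf hη]
    simp
    module
  add {η η'} hη hη' := by
    simp only [extDOnFields_eq, (lieD_tensorial hα).add hη hη']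
    simp
    module

/-- `2 dα(ξ, η) = ξ(α(η)) - η(α(ξ)) - α([ξ, η])` for all vector fields differentiable at `p`. -/
theorem extD_apply {α : ∀ p : P, TangentSpace 𝓘(ℝ, E) p →L[ℝ] W}
    (hα : SmoothOneForm α) {p : P} {ξ η : ∀ p : P, TangentSpace 𝓘(ℝ, E) p}
    (hξ : MDiffAt (T% ξ) p) (hη : MDiffAt (T% η) p) :
    extD α p (ξ p) (η p) = (1 / 2 : ℝ) • (mvfderiv 𝓘(ℝ, E) (fun q => α q (η q)) p (ξ p)
      - mvfderiv 𝓘(ℝ, E) (fun q => α q (ξ q)) p (η p) - α p (mlieBracket 𝓘(ℝ, E) ξ η p)) := by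
  have h₁ : ∀ τ : (∀ p : P, TangentSpace 𝓘(ℝ, E) p), MDiffAt (T% τ) p →
      TensorialAt 𝓘(ℝ, E) E (fun σ => extDOnFields α σ τ p) p := by
    intro τ _
    have h := extD_tensorial hα (ξ := τ) (p := p)
    refine ⟨fun {f σ} hf hσ => ?_, fun {σ σ'} hσ hσ' => ?_⟩
    · simp only [extDOnFields_swap α _ τ, h.smul hf hσ, smul_neg]
    · simp only [extDOnFields_swap α _ τ, h.add hσ hσ', neg_add]
  exact TensorialAt.pointwise₂ (Φ := fun σ τ => extDOnFields α σ τ p) h₁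
    (fun _ _ => extD_tensorial hα)
    (FiberBundle.mdifferentiableAt_extend ..) hξ (FiberBundle.mdifferentiableAt_extend ..) hη (by simp) (by simp)

end Forms

/-! ### Principal bundles, representations and connections -/

section Bundles

variable {EG : Type*} [NormedAddCommGroup EG] [NormedSpace ℝ EG]
  {G : Type*} [TopologicalSpace G] [ChartedSpace EG G] [Group G]
  {EM : Type*} [NormedAddCommGroup EM] [NormedSpace ℝ EM]
  {M : Type*} [TopologicalSpace M] [ChartedSpace EM M]
  {EP : Type*} [NormedAddCommGroup EP] [NormedSpace ℝ EP]
  {P : Type*} [TopologicalSpace P] [ChartedSpace EP P]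
  [MulAction Gᵐᵒᵖ P]
  {V : Type*} [NormedAddCommGroup V] [InnerProductSpace ℂ V] [CompleteSpace V]

variable (EG EM EP G) in
/-- `π : P → M` is a smooth principal `G`-bundle for the right action `p <• g` of `G` on `P`. -/
structure IsSmoothPrincipalBundle (π : P → M) : Prop where
  smooth_proj : ContMDiff 𝓘(ℝ, EP) 𝓘(ℝ, EM) ∞ π
  smooth_act : ContMDiff (𝓘(ℝ, EP).prod 𝓘(ℝ, EG)) 𝓘(ℝ, EP) ∞ (fun x : P × G => x.1 <• x.2)
  proj_act : ∀ (p : P) (g : G), π (p <• g) = π p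
  locally_trivial : ∀ m : M, ∃ e : Trivialization G π, m ∈ e.baseSet ∧
    ContMDiffOn 𝓘(ℝ, EP) (𝓘(ℝ, EM).prod 𝓘(ℝ, EG)) ∞ e e.source ∧
    ContMDiffOn (𝓘(ℝ, EM).prod 𝓘(ℝ, EG)) 𝓘(ℝ, EP) ∞ e.toOpenPartialHomeomorph.symm e.target ∧
    ∀ p ∈ e.source, ∀ g : G, e (p <• g) = (π p, (e p).2 * g)

variable (EG) in
/-- `T : G → Aut(V)` is a faithful (smooth) unitary representation. -/
structure IsFaithfulSmoothRep (T : G →* unitary (V →L[ℂ] V)) : Prop where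
  smooth : ContMDiff 𝓘(ℝ, EG) 𝓘(ℝ, V →L[ℂ] V) ∞ (fun g : G => (T g : V →L[ℂ] V))
  injective : Function.Injective T

variable (EG) in
/-- The derivative `DT(e) : 𝔤 = T_e G → B(V)`. -/
def repDeriv (T : G →* unitary (V →L[ℂ] V)) :
    TangentSpace 𝓘(ℝ, EG) (1 : G) →L[ℝ] (V →L[ℂ] V) :=
  mvfderiv 𝓘(ℝ, EG) (fun g : G => (T g : V →L[ℂ] V)) 1

open Classical in
variable (EG) in
/-- The element `A'` of `𝔤` with `DT(e)(A') = A`, for `A ∈ DT(e)(𝔤)` (and `0` for other `A`). -/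
def repDerivInv (T : G →* unitary (V →L[ℂ] V)) (A : V →L[ℂ] V) : TangentSpace 𝓘(ℝ, EG) (1 : G) :=
  if h : ∃ a, repDeriv EG T a = A then h.choose else 0

variable (EG G EP) in
/-- The derivative at `e` of the orbit map `g ↦ p g`, as a map `𝔤 → T_p P` (note `p e = p`);
it sends `a` to the velocity at `t = 0` of `t ↦ p exp(t a)`. -/
def orbitDeriv (p : P) : TangentSpace 𝓘(ℝ, EG) (1 : G) →L[ℝ] TangentSpace 𝓘(ℝ, EP) p :=
  mfderiv 𝓘(ℝ, EG) 𝓘(ℝ, EP) (fun g : G => p <• g) 1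

variable (EG EP) in
/-- The vertical vector at `p` defined by `A ∈ DT(e)(𝔤)`: the velocity at `t = 0` of
`t ↦ p exp(t A')`, where `DT(e)(A') = A`. For a function `F` on `P` with values in `DT(e)(𝔤)`, the
vertical vector field `F^*` is `p ↦ vertVec EG EP T p (F p)`. -/
def vertVec (T : G →* unitary (V →L[ℂ] V)) (p : P) (A : V →L[ℂ] V) : TangentSpace 𝓘(ℝ, EP) p :=
  orbitDeriv EG G EP p (repDerivInv EG T A)

/-- `ϑ` is a `DT(e)(𝔤)`-valued connection form. -/
structure IsConnectionForm [IsManifold 𝓘(ℝ, EP) ∞ P] (T : G →* unitary (V →L[ℂ] V))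
    (ϑ : ∀ p : P, TangentSpace 𝓘(ℝ, EP) p →L[ℝ] (V →L[ℂ] V)) : Prop where
  smooth : SmoothOneForm ϑ
  mem_range : ∀ p u, ϑ p u ∈ (repDeriv EG T).range
  orbit : ∀ (p : P) (a : TangentSpace 𝓘(ℝ, EG) (1 : G)),
    ϑ p (orbitDeriv EG G EP p a) = repDeriv EG T a
  equivariant : ∀ (p : P) (g : G) (u : TangentSpace 𝓘(ℝ, EP) p),
    ϑ (p <• g) (mfderiv 𝓘(ℝ, EP) 𝓘(ℝ, EP) (fun q : P => q <• g) p u) =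
      (T g⁻¹ : V →L[ℂ] V) * ϑ p u * (T g : V →L[ℂ] V)

variable (EG) in
/-- The vertical part of `u ∈ T_p P` in `T_p P = ker ϑ_p ⊕ ker Dπ(p)`. -/
def verPart (T : G →* unitary (V →L[ℂ] V))
    (ϑ : ∀ p : P, TangentSpace 𝓘(ℝ, EP) p →L[ℝ] (V →L[ℂ] V)) (p : P)
    (u : TangentSpace 𝓘(ℝ, EP) p) : TangentSpace 𝓘(ℝ, EP) p :=
  vertVec EG EP T p (ϑ p u)

variable (EG) in
/-- The horizontal part of `u ∈ T_p P` in `T_p P = ker ϑ_p ⊕ ker Dπ(p)`. -/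
def horPart (T : G →* unitary (V →L[ℂ] V))
    (ϑ : ∀ p : P, TangentSpace 𝓘(ℝ, EP) p →L[ℝ] (V →L[ℂ] V)) (p : P)
    (u : TangentSpace 𝓘(ℝ, EP) p) : TangentSpace 𝓘(ℝ, EP) p :=
  u - verPart EG T ϑ p u

open Classical in
/-- The horizontal lift to `p` of `w ∈ T_{π(p)} M`: the unique `u ∈ T_p P` with `ϑ_p(u) = 0` and
`Dπ(p) u = w`. The horizontal lift `X^*` of a vector field `X` on `M` is
`p ↦ horLift π ϑ p (X (π p))`. -/
def horLift (π : P → M) (ϑ : ∀ p : P, TangentSpace 𝓘(ℝ, EP) p →L[ℝ] (V →L[ℂ] V)) (p : P)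
    (w : TangentSpace 𝓘(ℝ, EM) (π p)) : TangentSpace 𝓘(ℝ, EP) p :=
  if h : ∃ u : TangentSpace 𝓘(ℝ, EP) p,
    ϑ p u = 0 ∧ mfderiv 𝓘(ℝ, EP) 𝓘(ℝ, EM) π p u = w then h.choose else 0

variable (EG) in
/-- The covariant differential `(𝐃F)(u) = dF(pr_hor u)` of a function. -/
def covDFun (T : G →* unitary (V →L[ℂ] V))
    (ϑ : ∀ p : P, TangentSpace 𝓘(ℝ, EP) p →L[ℝ] (V →L[ℂ] V)) (F : P → (V →L[ℂ] V)) (p : P)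
    (u : TangentSpace 𝓘(ℝ, EP) p) : V →L[ℂ] V :=
  mvfderiv 𝓘(ℝ, EP) F p (horPart EG T ϑ p u)

variable (EG) in
/-- The curvature form `Ω = 𝐃ϑ`, that is `Ω(u, v) = dϑ(pr_hor u, pr_hor v)`. -/
def curvature [IsManifold 𝓘(ℝ, EP) ∞ P] (T : G →* unitary (V →L[ℂ] V))
    (ϑ : ∀ p : P, TangentSpace 𝓘(ℝ, EP) p →L[ℝ] (V →L[ℂ] V)) (p : P)
    (u v : TangentSpace 𝓘(ℝ, EP) p) : V →L[ℂ] V :=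
  extD ϑ p (horPart EG T ϑ p u) (horPart EG T ϑ p v)

variable (EG EP P) in
/-- `C^∞_G(P, DT(e)(𝔤))`: smooth functions `F` with values in `DT(e)(𝔤)` such that
`F(p g) = T(g⁻¹) F(p) T(g)`. -/
def equivFunctions (T : G →* unitary (V →L[ℂ] V)) : Set (P → (V →L[ℂ] V)) :=
  {F | ContMDiff 𝓘(ℝ, EP) 𝓘(ℝ, V →L[ℂ] V) ∞ F ∧ (∀ p, F p ∈ (repDeriv EG T).range) ∧
    ∀ (p : P) (g : G), F (p <• g) = (T g⁻¹ : V →L[ℂ] V) * F p * (T g : V →L[ℂ] V)}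

variable [IsManifold 𝓘(ℝ, EP) ∞ P] [IsManifold 𝓘(ℝ, EM) ∞ M]

variable (G EP P) in
/-- `C^∞_G(P, TP)`: smooth vector fields `ξ` on `P` with `ξ(p g) = DR_g(p) ξ(p)`. -/
def invariantFields : Set (SmoothVF EP P) :=
  {ξ | ∀ (p : P) (g : G),
    ξ (p <• g) = mfderiv 𝓘(ℝ, EP) 𝓘(ℝ, EP) (fun q : P => q <• g) p (ξ p)}

variable (G) in
/-- `ℰ_G^0`: the `ξ ∈ C^∞_G(P, TP)` with `ℒ_ξ ϑ = 0`. -/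
def setE (ϑ : ∀ p : P, TangentSpace 𝓘(ℝ, EP) p →L[ℝ] (V →L[ℂ] V)) : Set (SmoothVF EP P) :=
  {ξ | ξ ∈ invariantFields G EP P ∧ ∀ p v, lieD ξ ϑ p v = 0}

variable (G EM) in
/-- `ℋ_G^0 = Dπ(ℰ_G^0)`. -/
def setH (π : P → M) (ϑ : ∀ p : P, TangentSpace 𝓘(ℝ, EP) p →L[ℝ] (V →L[ℂ] V)) :
    Set (SmoothVF EM M) :=
  {X | ∃ ξ ∈ setE G ϑ, ∀ p, mfderiv 𝓘(ℝ, EP) 𝓘(ℝ, EM) π p (ξ p) = X (π p)}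

variable (EG) in
/-- `𝒩_G`: the `F ∈ C^∞_G(P, DT(e)(𝔤))` with `𝐃F = 0`. -/
def setN (T : G →* unitary (V →L[ℂ] V))
    (ϑ : ∀ p : P, TangentSpace 𝓘(ℝ, EP) p →L[ℝ] (V →L[ℂ] V)) : Set (P → (V →L[ℂ] V)) :=
  {F | F ∈ equivFunctions EG EP P T ∧ ∀ p v, covDFun EG T ϑ F p v = 0}

variable (EG EM) in
/-- `ℱ_G^0`: the pairs `(F, X) ∈ C^∞_G(P, DT(e)(𝔤)) × ℋ_G^0` with `X^* ⌟ Ω = 𝐃F`. -/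
def setF (π : P → M) (T : G →* unitary (V →L[ℂ] V))
    (ϑ : ∀ p : P, TangentSpace 𝓘(ℝ, EP) p →L[ℝ] (V →L[ℂ] V)) :
    Set ((P → (V →L[ℂ] V)) × SmoothVF EM M) :=
  {a | a.1 ∈ equivFunctions EG EP P T ∧ a.2 ∈ setH G EM π ϑ ∧
    ∀ p v, interiorProd (curvature EG T ϑ) p (horLift π ϑ p (a.2 (π p))) v =
      covDFun EG T ϑ a.1 p v}

end Bundles

end

attribute [local instance] LieRing.ofAssociativeRing

/-! A tangent vector `u` at `p` is determined by the pair `(ϑ u, Dπ u)`: the kernel of `Dπ` consists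
of fundamental vectors, on which `ϑ` is `DT(e)`, and `DT(e)` is injective because `T` is. Hence an
invariant field `ξ` is the same as the pair consisting of the equivariant function `F = -ϑ(ξ)` and
the projected field `X`, with `ξ = X^* - F^*`.

What remains is to read `ℒ_ξ ϑ = 0` in terms of `(F, X)`. Cartan's formula gives `(ℒ_ξ ϑ)(v) = 2
dϑ(ξ, v) - dF(v)`. For vertical `v` the right side vanishes for every invariant `ξ`, since `2
dϑ(a^*, v) = [ϑ(v), DT(e)(a)]` (`two_smul_extD_orbitDeriv`) matches the derivative of an equivariant
function along `a^*` (`mvfderiv_orbitDeriv`). For horizontal `v` it is `(X^* ⌟ Ω - 𝐃F)(v)`. So `ℒ_ξ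
ϑ = 0` exactly when `X^* ⌟ Ω = 𝐃F` (`lieD_theta_eq`, `mem_setE_iff`), which makes `ξ ↦ (F, X)` a
bijection from `ℰ_G^0` onto `ℱ_G^0`.

The Lie algebra structure of `ℱ_G^0` is transported along this bijection, so the Jacobi identity
needs no computation; only the formula for the bracket does. Brackets of projectable fields project.
If `ℒ_ξ ϑ = 0` then `-ϑ([ξ, η]) = ξ(F_η)`; its horizontal part is `𝐃F_η(ξ) = -2 Ω(ξ, η)` and its
vertical part is `[F_ξ, F_η]` (`neg_theta_lie`). In the sequence, `X = 0` turns the condition on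
`(F, X)` into `𝐃F = 0`, and surjectivity holds because `ℋ_G^0` is by definition the projection of
`ℰ_G^0`. -/

set_option linter.unusedSectionVars false

/-! ### Coordinate fields, and the bracket as a commutator of derivations. -/

section Fields

variable {E : Type*} [NormedAddCommGroup E] [NormedSpace ℝ E]
  {P : Type*} [TopologicalSpace P] [ChartedSpace E P] [IsManifold 𝓘(ℝ, E) ∞ P]
  {W : Type*} [NormedAddCommGroup W] [NormedSpace ℝ W]

/-- The coordinate field of the chart at `p` with coordinates `v`. -/
noncomputable def chartField (p : P) (v : E) : ∀ q : P, TangentSpace 𝓘(ℝ, E) q :=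
  FiberBundle.extend (E := fun q : P => TangentSpace 𝓘(ℝ, E) q) (x := p) E v

theorem mvfderiv_extChartAt_injective {p q : P} (hq : q ∈ (chartAt E p).source) :
    Function.Injective (mvfderiv 𝓘(ℝ, E) (extChartAt 𝓘(ℝ, E) p) q) :=
  (isInvertible_mfderiv_extChartAt (I := 𝓘(ℝ, E)) (x := p) (y := q) (by simpa using hq)).injective

theorem mvfderiv_extChartAt_chartField {p q : P} (v : E) (hq : q ∈ (chartAt E p).source) :
    mvfderiv 𝓘(ℝ, E) (extChartAt 𝓘(ℝ, E) p) q (chartField p v q) = v := by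
  have h2 := TangentBundle.continuousLinearMapAt_trivializationAt (I := 𝓘(ℝ, E))
    (mem_chart_source E p)
  -- At its own base point the preferred trivialization is the identity, so the field extending `v`
  -- has constant coordinates `v`.
  rw [mfderiv_extChartAt_self] at h2
  have h3 : ((trivializationAt E (TangentSpace 𝓘(ℝ, E)) p)
      (TotalSpace.mk' E (E := fun q : P => TangentSpace 𝓘(ℝ, E) q) p v)).2 = v := by
    have h4 := congrFun (Trivialization.coe_linearMapAt_of_mem (R := ℝ)
      (trivializationAt E (TangentSpace 𝓘(ℝ, E)) p) (b := p)
      (FiberBundle.mem_baseSet_trivializationAt' p)) v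
    exact h4.symm.trans (DFunLike.congr_fun h2 v)
  have h5 : chartField p v q =
      Trivialization.symmL ℝ (trivializationAt E (TangentSpace 𝓘(ℝ, E)) p) q v := by
    rw [Trivialization.symmL_apply _ hq]
    exact congrArg _ h3
  have h6 := Trivialization.continuousLinearMapAt_symmL (R := ℝ)
    (trivializationAt E (TangentSpace 𝓘(ℝ, E)) p) (b := q) hq v
  rw [← h5] at h6
  exact (DFunLike.congr_fun (TangentBundle.continuousLinearMapAt_trivializationAt
    (I := 𝓘(ℝ, E)) hq) (chartField p v q)).symm.trans h6

theorem chartField_mvfderiv_extChartAt {p q : P} (v : TangentSpace 𝓘(ℝ, E) q)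
    (hq : q ∈ (chartAt E p).source) :
    chartField p (mvfderiv 𝓘(ℝ, E) (extChartAt 𝓘(ℝ, E) p) q v) q = v :=
  mvfderiv_extChartAt_injective hq (mvfderiv_extChartAt_chartField (p := p) (q := q) _ hq)

theorem contMDiffAt_chartField (p : P) (v : E) :
    ContMDiffAt 𝓘(ℝ, E) (𝓘(ℝ, E).prod 𝓘(ℝ, E)) ∞
      (fun q => TotalSpace.mk' E q (chartField p v q)) p :=
  FiberBundle.contMDiffAt_extend (V := fun q : P => TangentSpace 𝓘(ℝ, E) q) 𝓘(ℝ, E) E v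

theorem mdifferentiableAt_chartField (p : P) (v : E) : MDiffAt (T% (chartField p v)) p :=
  (contMDiffAt_chartField p v).mdifferentiableAt (by simp)

/-- Near `p` coordinate fields are pullbacks along the chart of constant fields, which commute. -/
theorem mlieBracket_chartField [CompleteSpace E] (p : P) (u v : E) :
    mlieBracket 𝓘(ℝ, E) (chartField p u) (chartField p v) p = 0 := by
  have : IsManifold 𝓘(ℝ, E) (minSmoothness ℝ 2) P := by
    simpa using (inferInstance : IsManifold 𝓘(ℝ, E) 2 P)
  have : IsManifold 𝓘(ℝ, E) (minSmoothness ℝ 3) P := by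
    simpa using (inferInstance : IsManifold 𝓘(ℝ, E) 3 P)
  let c : E → ∀ x : E, TangentSpace 𝓘(ℝ, E) x := fun w _ => w
  have key : ∀ w : E, chartField p w =ᶠ[nhds p]
      mpullback 𝓘(ℝ, E) 𝓘(ℝ, E) (extChartAt 𝓘(ℝ, E) p) (c w) := by
    intro w
    filter_upwards [(chartAt E p).open_source.mem_nhds (mem_chart_source E p)] with q hq
    have hi := isInvertible_mfderiv_extChartAt (I := 𝓘(ℝ, E)) (x := p) (y := q) (by simpa using hq)
    exact hi.injective ((mvfderiv_extChartAt_chartField _ hq).trans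
      (hi.self_apply_inverse (c w _)).symm)
  have hc : ∀ w : E, MDiffAt (T% (c w)) (extChartAt 𝓘(ℝ, E) p p) := by
    intro w
    have : ContMDiffAt 𝓘(ℝ, E) 𝓘(ℝ, E).tangent 1 (T% (c w)) (extChartAt 𝓘(ℝ, E) p p) :=
      contMDiffAt_vectorSpace_iff_contDiffAt.2 contDiffAt_const
    exact this.mdifferentiableAt one_ne_zero
  rw [Filter.EventuallyEq.mlieBracket_vectorField_eq (key u) (key v),
    ← mpullback_mlieBracket (n := minSmoothness ℝ 2) (hc u) (hc v) contMDiffAt_extChartAt le_rfl,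
    mpullback_apply]
  have : mlieBracket 𝓘(ℝ, E) (c u) (c v) = 0 := by
    rw [← mlieBracketWithin_univ]
    refine mlieBracketWithin_eq_lieBracketWithin.trans ?_
    ext x
    simp [lieBracket, c]
    rfl
  rw [this]
  exact map_zero _

/-- The assumption on `α` concerns the point `p` only, so that `α = df` is allowed for a function
`f` known to be smooth only at `p`, such as a chart. -/
theorem lieDOnFields_tensorial [FiniteDimensional ℝ E]
    {α : ∀ p : P, TangentSpace 𝓘(ℝ, E) p →L[ℝ] W} {p : P}
    (hα : ∀ η : ∀ p : P, TangentSpace 𝓘(ℝ, E) p, MDiffAt (T% η) p →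
      MDifferentiableAt 𝓘(ℝ, E) 𝓘(ℝ, W) (fun q => α q (η q)) p)
    {ξ : ∀ p : P, TangentSpace 𝓘(ℝ, E) p} :
    TensorialAt 𝓘(ℝ, E) E (fun η => lieDOnFields ξ α η p) p where
  smul {f η} hf hη := by
    have : CompleteSpace E := FiniteDimensional.complete ℝ E
    have h := mvfderiv_fun_smul hf (hα _ hη)
    have e : (fun q => α q ((f • η) q)) = fun q => f q • α q (η q) := by
      ext1 q; simp
    simp only [lieDOnFields, e, h, mlieBracket_smul_right hf hη]
    simp
    module
  add {η η'} hη hη' := by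
    have : CompleteSpace E := FiniteDimensional.complete ℝ E
    have h := mvfderiv_fun_add (hα _ hη) (hα _ hη')
    have e : (fun q => α q ((η + η') q)) = fun q => α q (η q) + α q (η' q) := by
      ext1 q; simp
    simp only [lieDOnFields, e, h, mlieBracket_add_right hη hη']
    simp
    module

theorem extDOnFields_tensorial_right [FiniteDimensional ℝ E]
    {α : ∀ p : P, TangentSpace 𝓘(ℝ, E) p →L[ℝ] W} {p : P}
    (hα : ∀ η : ∀ p : P, TangentSpace 𝓘(ℝ, E) p, MDiffAt (T% η) p →
      MDifferentiableAt 𝓘(ℝ, E) 𝓘(ℝ, W) (fun q => α q (η q)) p)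
    {ξ : ∀ p : P, TangentSpace 𝓘(ℝ, E) p} :
    TensorialAt 𝓘(ℝ, E) E (fun η => extDOnFields α ξ η p) p where
  smul {f η} hf hη := by
    simp only [extDOnFields_eq, (lieDOnFields_tensorial hα).smul hf hη]
    simp
    module
  add {η η'} hη hη' := by
    simp only [extDOnFields_eq, (lieDOnFields_tensorial hα).add hη hη']
    simp
    module

theorem extDOnFields_tensorial_left [FiniteDimensional ℝ E]
    {α : ∀ p : P, TangentSpace 𝓘(ℝ, E) p →L[ℝ] W} {p : P}
    (hα : ∀ η : ∀ p : P, TangentSpace 𝓘(ℝ, E) p, MDiffAt (T% η) p →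
      MDifferentiableAt 𝓘(ℝ, E) 𝓘(ℝ, W) (fun q => α q (η q)) p)
    {η : ∀ p : P, TangentSpace 𝓘(ℝ, E) p} :
    TensorialAt 𝓘(ℝ, E) E (fun ξ => extDOnFields α ξ η p) p where
  smul {f σ} hf hσ := by
    simp only [extDOnFields_swap α _ η, (extDOnFields_tensorial_right hα).smul hf hσ, smul_neg]
  add {σ σ'} hσ hσ' := by
    simp only [extDOnFields_swap α _ η, (extDOnFields_tensorial_right hα).add hσ hσ', neg_add]

/-- The exterior derivative in the coordinates of the chart at `p`. -/
theorem extDOnFields_eq_chartField [FiniteDimensional ℝ E]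
    {α : ∀ p : P, TangentSpace 𝓘(ℝ, E) p →L[ℝ] W} {p : P}
    (hα : ∀ η : ∀ p : P, TangentSpace 𝓘(ℝ, E) p, MDiffAt (T% η) p →
      MDifferentiableAt 𝓘(ℝ, E) 𝓘(ℝ, W) (fun q => α q (η q)) p)
    {ξ η : ∀ p : P, TangentSpace 𝓘(ℝ, E) p} (hξ : MDiffAt (T% ξ) p) (hη : MDiffAt (T% η) p)
    {u v : E} (hu : chartField p u p = ξ p) (hv : chartField p v p = η p) :
    extDOnFields α ξ η p = (1 / 2 : ℝ) •
      (mvfderiv 𝓘(ℝ, E) (fun q => α q (chartField p v q)) p (ξ p)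
        - mvfderiv 𝓘(ℝ, E) (fun q => α q (chartField p u q)) p (η p)) := by
  have : CompleteSpace E := FiniteDimensional.complete ℝ E
  -- By tensoriality the fields may be replaced by coordinate fields, whose bracket term vanishes.
  have h : extDOnFields α ξ η p = extDOnFields α (chartField p u) (chartField p v) p :=
    TensorialAt.pointwise₂ (Φ := fun σ τ => extDOnFields α σ τ p)
      (fun _ _ => extDOnFields_tensorial_left hα) (fun _ _ => extDOnFields_tensorial_right hα)
      hξ (mdifferentiableAt_chartField p _) hη (mdifferentiableAt_chartField p _) hu.symm hv.symm
  rw [h, extDOnFields, mlieBracket_chartField, map_zero, sub_zero, hu, hv]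

section LocalFunctions

theorem one_add_one_le_infty : (1 + 1 : ℕ∞ω) ≤ ∞ := by
  rw [one_add_one_eq_two]
  exact WithTop.coe_le_coe.2 (le_top : (2 : ℕ∞) ≤ ⊤)

omit [IsManifold 𝓘(ℝ, E) ∞ P] in
theorem mvfderiv_comp_fderiv_apply {W' : Type*} [NormedAddCommGroup W'] [NormedSpace ℝ W']
    {g : W' → W} {f : P → W'} {p : P} (hg : DifferentiableAt ℝ g (f p))
    (hf : MDifferentiableAt 𝓘(ℝ, E) 𝓘(ℝ, W') f p) (u : TangentSpace 𝓘(ℝ, E) p) :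
    mvfderiv 𝓘(ℝ, E) (g ∘ f) p u = fderiv ℝ g (f p) (mvfderiv 𝓘(ℝ, E) f p u) := by
  have h := mfderiv_comp_apply p hg.mdifferentiableAt hf u
  rw [mfderiv_eq_fderiv] at h
  exact h

variable {f : P → W} {p : P}

omit [IsManifold 𝓘(ℝ, E) ∞ P] in
theorem ContMDiffAt.contDiffAt_comp_extChartAt_symm (hf : ContMDiffAt 𝓘(ℝ, E) 𝓘(ℝ, W) ∞ f p) :
    ContDiffAt ℝ ∞ (f ∘ (extChartAt 𝓘(ℝ, E) p).symm) (extChartAt 𝓘(ℝ, E) p p) := by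
  have h := (contMDiffAt_iff.1 hf).2
  simp only [mfld_simps] at h
  exact h.contDiffAt Filter.univ_mem

theorem ContMDiffAt.eventually_mvfderiv_eq (hf : ContMDiffAt 𝓘(ℝ, E) 𝓘(ℝ, W) ∞ f p) :
    ∀ᶠ q in nhds p, ∀ u, mvfderiv 𝓘(ℝ, E) f q u =
      fderiv ℝ (f ∘ (extChartAt 𝓘(ℝ, E) p).symm) (extChartAt 𝓘(ℝ, E) p q)
        (mvfderiv 𝓘(ℝ, E) (extChartAt 𝓘(ℝ, E) p) q u) := by
  have h1 : ∀ᶠ x in nhds (extChartAt 𝓘(ℝ, E) p p),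
      DifferentiableAt ℝ (f ∘ (extChartAt 𝓘(ℝ, E) p).symm) x := by
    have := (hf.contDiffAt_comp_extChartAt_symm.of_le (m := 1)
      (by exact_mod_cast le_top)).eventually (by simp)
    exact this.mono fun x hx => hx.differentiableAt one_ne_zero
  have h2 := (continuousAt_extChartAt (I := 𝓘(ℝ, E)) p).eventually h1
  have h3 := (chartAt E p).open_source.mem_nhds (mem_chart_source E p)
  filter_upwards [h2, h3] with q hq1 hq2 u
  have e : f =ᶠ[nhds q]
      (f ∘ (extChartAt 𝓘(ℝ, E) p).symm) ∘ (extChartAt 𝓘(ℝ, E) p) := by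
    filter_upwards [(chartAt E p).open_source.mem_nhds hq2] with r hr
    simp [(chartAt E p).left_inv hr]
  have h4 : mvfderiv 𝓘(ℝ, E) f q =
      mvfderiv 𝓘(ℝ, E) ((f ∘ (extChartAt 𝓘(ℝ, E) p).symm) ∘ (extChartAt 𝓘(ℝ, E) p)) q :=
    e.mfderiv_eq
  rw [h4, mvfderiv_comp_fderiv_apply hq1 (mdifferentiableAt_extChartAt hq2)]

theorem mdifferentiableAt_mvfderiv_extChartAt {η : ∀ q : P, TangentSpace 𝓘(ℝ, E) q}
    (hη : MDiffAt (T% η) p) :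
    MDifferentiableAt 𝓘(ℝ, E) 𝓘(ℝ, E)
      (fun q => mvfderiv 𝓘(ℝ, E) (extChartAt 𝓘(ℝ, E) p) q (η q)) p := by
  have h := (mdifferentiableAt_section _ _).1 hη
  refine h.congr_of_eventuallyEq ?_
  filter_upwards [(chartAt E p).open_source.mem_nhds (mem_chart_source E p)] with q hq
  have h4 := congrFun (Trivialization.coe_linearMapAt_of_mem (R := ℝ)
      (trivializationAt E (TangentSpace 𝓘(ℝ, E)) p) (b := q) hq) (η q)
  exact (DFunLike.congr_fun (TangentBundle.continuousLinearMapAt_trivializationAt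
    (I := 𝓘(ℝ, E)) hq) (η q)).symm.trans h4

theorem ContMDiffAt.mdifferentiableAt_mvfderiv_apply (hf : ContMDiffAt 𝓘(ℝ, E) 𝓘(ℝ, W) ∞ f p)
    {η : ∀ q : P, TangentSpace 𝓘(ℝ, E) q} (hη : MDiffAt (T% η) p) :
    MDifferentiableAt 𝓘(ℝ, E) 𝓘(ℝ, W) (fun q => mvfderiv 𝓘(ℝ, E) f q (η q)) p := by
  have h1 : DifferentiableAt ℝ (fderiv ℝ (f ∘ (extChartAt 𝓘(ℝ, E) p).symm))
      (extChartAt 𝓘(ℝ, E) p p) :=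
    (hf.contDiffAt_comp_extChartAt_symm.fderiv_right (m := 1)
      one_add_one_le_infty).differentiableAt one_ne_zero
  have h2 : MDifferentiableAt 𝓘(ℝ, E) 𝓘(ℝ, E →L[ℝ] W)
      (fun q => fderiv ℝ (f ∘ (extChartAt 𝓘(ℝ, E) p).symm) (extChartAt 𝓘(ℝ, E) p q)) p :=
    h1.mdifferentiableAt.comp p (mdifferentiableAt_extChartAt (mem_chart_source E p))
  refine (h2.clm_apply (mdifferentiableAt_mvfderiv_extChartAt hη)).congr_of_eventuallyEq ?_
  filter_upwards [hf.eventually_mvfderiv_eq] with q hq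
  exact hq _

/-- Expresses an iterated derivative as the second derivative of the coordinate expression of `f`,
whose symmetry then becomes available. -/
theorem mvfderiv_mvfderiv_chartField (hf : ContMDiffAt 𝓘(ℝ, E) 𝓘(ℝ, W) ∞ f p)
    (u : TangentSpace 𝓘(ℝ, E) p) (v : E) :
    mvfderiv 𝓘(ℝ, E) (fun q => mvfderiv 𝓘(ℝ, E) f q (chartField p v q)) p u =
      fderiv ℝ (fderiv ℝ (f ∘ (extChartAt 𝓘(ℝ, E) p).symm)) (extChartAt 𝓘(ℝ, E) p p)
        (mvfderiv 𝓘(ℝ, E) (extChartAt 𝓘(ℝ, E) p) p u) v := by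
  set g := f ∘ (extChartAt 𝓘(ℝ, E) p).symm with hg
  have h1 : DifferentiableAt ℝ (fderiv ℝ g) (extChartAt 𝓘(ℝ, E) p p) :=
    (hf.contDiffAt_comp_extChartAt_symm.fderiv_right (m := 1)
      one_add_one_le_infty).differentiableAt one_ne_zero
  have e : (fun q => mvfderiv 𝓘(ℝ, E) f q (chartField p v q)) =ᶠ[nhds p]
      (fun x => fderiv ℝ g x v) ∘ extChartAt 𝓘(ℝ, E) p := by
    filter_upwards [hf.eventually_mvfderiv_eq,
      (chartAt E p).open_source.mem_nhds (mem_chart_source E p)] with q hq hq2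
    rw [hq, mvfderiv_extChartAt_chartField _ hq2]
    rfl
  have h2 : DifferentiableAt ℝ (fun x => fderiv ℝ g x v) (extChartAt 𝓘(ℝ, E) p p) :=
    h1.clm_apply (differentiableAt_const v)
  have h4 : mvfderiv 𝓘(ℝ, E) (fun q => mvfderiv 𝓘(ℝ, E) f q (chartField p v q)) p =
      mvfderiv 𝓘(ℝ, E) ((fun x => fderiv ℝ g x v) ∘ extChartAt 𝓘(ℝ, E) p) p :=
    e.mfderiv_eq
  rw [h4, mvfderiv_comp_fderiv_apply h2 (mdifferentiableAt_extChartAt (mem_chart_source E p)),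
    fderiv_clm_apply h1 (differentiableAt_const v)]
  simp

/-- `[ξ, η] f = ξ (η f) - η (ξ f)`. -/
theorem mvfderiv_mlieBracket [FiniteDimensional ℝ E] (hf : ContMDiffAt 𝓘(ℝ, E) 𝓘(ℝ, W) ∞ f p)
    {ξ η : ∀ q : P, TangentSpace 𝓘(ℝ, E) q} (hξ : MDiffAt (T% ξ) p) (hη : MDiffAt (T% η) p) :
    mvfderiv 𝓘(ℝ, E) f p (mlieBracket 𝓘(ℝ, E) ξ η p) =
      mvfderiv 𝓘(ℝ, E) (fun q => mvfderiv 𝓘(ℝ, E) f q (η q)) p (ξ p)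
        - mvfderiv 𝓘(ℝ, E) (fun q => mvfderiv 𝓘(ℝ, E) f q (ξ q)) p (η p) := by
  -- The claim is `d(df) = 0` written out by the invariant formula; in coordinates it is the
  -- symmetry of the second derivative.
  have h := extDOnFields_eq_chartField (α := fun q => mvfderiv 𝓘(ℝ, E) f q)
    (fun η hη => hf.mdifferentiableAt_mvfderiv_apply hη) hξ hη
    (chartField_mvfderiv_extChartAt _ (mem_chart_source E p))
    (chartField_mvfderiv_extChartAt _ (mem_chart_source E p))
  rw [mvfderiv_mvfderiv_chartField hf, mvfderiv_mvfderiv_chartField hf] at h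
  have hs : IsSymmSndFDerivAt ℝ (f ∘ (extChartAt 𝓘(ℝ, E) p).symm) (extChartAt 𝓘(ℝ, E) p p) :=
    hf.contDiffAt_comp_extChartAt_symm.isSymmSndFDerivAt (by
      rw [minSmoothness_of_isRCLikeNormedField, ← one_add_one_eq_two]
      exact one_add_one_le_infty)
  rw [hs.eq, sub_self, smul_zero, extDOnFields, smul_eq_zero] at h
  exact (sub_eq_zero.1 (h.resolve_left (by norm_num))).symm

end LocalFunctions

end Fields

/-! ### Naturality of the exterior derivative. -/

section Pullback

variable {E : Type*} [NormedAddCommGroup E] [NormedSpace ℝ E] [FiniteDimensional ℝ E]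
  {P : Type*} [TopologicalSpace P] [ChartedSpace E P] [IsManifold 𝓘(ℝ, E) ∞ P]
  {W : Type*} [NormedAddCommGroup W] [NormedSpace ℝ W]
  {Z : Type*} [NormedAddCommGroup Z] [NormedSpace ℝ Z]

omit [FiniteDimensional ℝ E] in
theorem chartField_sum {ι : Type*} (s : Finset ι) {p q : P} (hq : q ∈ (chartAt E p).source)
    (c : ι → ℝ) (v : ι → E) :
    chartField p (∑ i ∈ s, c i • v i) q = ∑ i ∈ s, c i • chartField p (v i) q := by
  apply mvfderiv_extChartAt_injective hq
  simp_rw [map_sum, map_smul, mvfderiv_extChartAt_chartField _ hq]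

/-- The coefficients of a one-form in the chart at `p`. -/
noncomputable def chartCoeff (α : ∀ p : P, TangentSpace 𝓘(ℝ, E) p →L[ℝ] W) (p q : P) : E →L[ℝ] W :=
  ∑ i, ((Module.finBasis ℝ E).coord i).toContinuousLinearMap.smulRight
    (α q (chartField p (Module.finBasis ℝ E i) q))

theorem chartCoeff_apply (α : ∀ p : P, TangentSpace 𝓘(ℝ, E) p →L[ℝ] W) {p q : P}
    (hq : q ∈ (chartAt E p).source) (v : E) :
    chartCoeff α p q v = α q (chartField p v q) := by
  conv_rhs => rw [← (Module.finBasis ℝ E).sum_repr v, chartField_sum _ hq]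
  simp [chartCoeff]

theorem mdifferentiableAt_chartCoeff {α : ∀ p : P, TangentSpace 𝓘(ℝ, E) p →L[ℝ] W}
    (hα : SmoothOneForm α) (p : P) :
    MDifferentiableAt 𝓘(ℝ, E) 𝓘(ℝ, E →L[ℝ] W) (chartCoeff α p) p := by
  have h : ∀ i, MDifferentiableAt 𝓘(ℝ, E) 𝓘(ℝ, E →L[ℝ] W)
      (fun q => ((Module.finBasis ℝ E).coord i).toContinuousLinearMap.smulRight
        (α q (chartField p (Module.finBasis ℝ E i) q))) p := fun i =>
    ((ContinuousLinearMap.smulRightL ℝ E W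
      ((Module.finBasis ℝ E).coord i).toContinuousLinearMap).differentiableAt
        |>.mdifferentiableAt).comp p (hα.mdifferentiableAt (mdifferentiableAt_chartField p _))
  have h' : ∀ s : Finset (Fin (Module.finrank ℝ E)), MDifferentiableAt 𝓘(ℝ, E) 𝓘(ℝ, E →L[ℝ] W)
      (fun q => ∑ i ∈ s, ((Module.finBasis ℝ E).coord i).toContinuousLinearMap.smulRight
        (α q (chartField p (Module.finBasis ℝ E i) q))) p := by
    intro s
    induction s using Finset.cons_induction with
    | empty => simpa using mdifferentiableAt_const
    | cons i s hi ih =>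
      simp_rw [Finset.sum_cons]
      exact (h i).add ih
  exact h' Finset.univ

/-- The exterior derivative commutes with the pullback along a map from a normed space. -/
theorem extD_pullback {α : ∀ p : P, TangentSpace 𝓘(ℝ, E) p →L[ℝ] W} (hα : SmoothOneForm α)
    {f : Z → P} {z : Z} (hf : ContMDiffAt 𝓘(ℝ, Z) 𝓘(ℝ, E) ∞ f z) (a b : Z) :
    (2 : ℝ) • extD α (f z) (mfderiv 𝓘(ℝ, Z) 𝓘(ℝ, E) f z a) (mfderiv 𝓘(ℝ, Z) 𝓘(ℝ, E) f z b) =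
      fderiv ℝ (fun y => α (f y) (mfderiv 𝓘(ℝ, Z) 𝓘(ℝ, E) f y b)) z a
        - fderiv ℝ (fun y => α (f y) (mfderiv 𝓘(ℝ, Z) 𝓘(ℝ, E) f y a)) z b ∧
    ∀ w, DifferentiableAt ℝ (fun y => α (f y) (mfderiv 𝓘(ℝ, Z) 𝓘(ℝ, E) f y w)) z := by
  set p := f z with hp
  have hps := mem_chart_source E p
  -- With `A = chartCoeff α p` and `C` the map `f` in the chart, the pulled-back form is `y ↦ A(f y)
  -- (C'(y) w)`. Its derivative along `a` is a term with `A'` plus `A (C''(a, w))`; the second kind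
  -- cancels on antisymmetrizing.
  set C : Z → E := extChartAt 𝓘(ℝ, E) p ∘ f with hC
  have hCs : ContDiffAt ℝ ∞ C z :=
    ((contMDiffAt_extChartAt (I := 𝓘(ℝ, E)) (n := ∞) (x := p)).comp z hf).contDiffAt
  have hf1 : MDifferentiableAt 𝓘(ℝ, Z) 𝓘(ℝ, E) f z := hf.mdifferentiableAt (by simp)
  have hev : ∀ᶠ y in nhds z, f y ∈ (chartAt E p).source ∧
      MDifferentiableAt 𝓘(ℝ, Z) 𝓘(ℝ, E) f y := by
    refine (hf.continuousAt.eventually ((chartAt E p).open_source.mem_nhds hps)).and ?_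
    have := (contMDiffAt_iff_contMDiffAt_nhds (n := 1) (by simp)).1
      (hf.of_le (by exact_mod_cast le_top))
    exact this.mono fun y hy => hy.mdifferentiableAt one_ne_zero
  have hCd : ∀ y, f y ∈ (chartAt E p).source → MDifferentiableAt 𝓘(ℝ, Z) 𝓘(ℝ, E) f y → ∀ w : Z,
      mvfderiv 𝓘(ℝ, E) (extChartAt 𝓘(ℝ, E) p) (f y) (mfderiv 𝓘(ℝ, Z) 𝓘(ℝ, E) f y w) =
        fderiv ℝ C y w := by
    intro y h1 h2 w
    have := mfderiv_comp_apply y (mdifferentiableAt_extChartAt (I := 𝓘(ℝ, E)) h1) h2 w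
    rw [mfderiv_eq_fderiv] at this
    exact this.symm
  have hw : ∀ w : Z, (fun y => α (f y) (mfderiv 𝓘(ℝ, Z) 𝓘(ℝ, E) f y w)) =ᶠ[nhds z]
      fun y => chartCoeff α p (f y) (fderiv ℝ C y w) := by
    intro w
    filter_upwards [hev] with y hy
    rw [chartCoeff_apply α hy.1, ← hCd y hy.1 hy.2, chartField_mvfderiv_extChartAt _ hy.1]
  have hA := mdifferentiableAt_chartCoeff hα p
  have hB : DifferentiableAt ℝ (chartCoeff α p ∘ f) z :=
    (MDifferentiableAt.comp z hA hf1).differentiableAt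
  have hBd : ∀ w, fderiv ℝ (chartCoeff α p ∘ f) z w =
      mvfderiv 𝓘(ℝ, E) (chartCoeff α p) p (mfderiv 𝓘(ℝ, Z) 𝓘(ℝ, E) f z w) := by
    intro w
    have := mfderiv_comp_apply z hA hf1 w
    rw [mfderiv_eq_fderiv] at this
    exact this
  have hC1 : DifferentiableAt ℝ (fderiv ℝ C) z :=
    (hCs.fderiv_right (m := 1) one_add_one_le_infty).differentiableAt one_ne_zero
  have hder : ∀ a b : Z, fderiv ℝ (fun y => α (f y) (mfderiv 𝓘(ℝ, Z) 𝓘(ℝ, E) f y b)) z a =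
      mvfderiv 𝓘(ℝ, E) (chartCoeff α p) p (mfderiv 𝓘(ℝ, Z) 𝓘(ℝ, E) f z a) (fderiv ℝ C z b)
        + chartCoeff α p p (fderiv ℝ (fderiv ℝ C) z a b) := by
    intro a b
    have h1 : DifferentiableAt ℝ (fun y => fderiv ℝ C y b) z :=
      hC1.clm_apply (differentiableAt_const b)
    have h2 : fderiv ℝ (fun y => fderiv ℝ C y b) z a = fderiv ℝ (fderiv ℝ C) z a b := by
      rw [fderiv_clm_apply hC1 (differentiableAt_const b)]
      simp
    have h3 := fderiv_clm_apply hB h1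
    rw [(hw b).fderiv_eq]
    refine (DFunLike.congr_fun h3 a).trans ?_
    simp only [add_apply, ContinuousLinearMap.comp_apply, ContinuousLinearMap.flip_apply]
    rw [h2, hBd, add_comm]
    rfl
  have hs : IsSymmSndFDerivAt ℝ C z := hCs.isSymmSndFDerivAt (by
      rw [minSmoothness_of_isRCLikeNormedField, ← one_add_one_eq_two]
      exact one_add_one_le_infty)
  have hm : ∀ w : Z, chartField p (fderiv ℝ C z w) p = mfderiv 𝓘(ℝ, Z) 𝓘(ℝ, E) f z w := by
    intro w
    rw [← hCd z hps hf1 w]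
    exact chartField_mvfderiv_extChartAt _ hps
  have hcoef : ∀ (u : TangentSpace 𝓘(ℝ, E) p) (v : E),
      mvfderiv 𝓘(ℝ, E) (fun q => α q (chartField p v q)) p u =
        mvfderiv 𝓘(ℝ, E) (chartCoeff α p) p u v := by
    intro u v
    have e : (fun q => α q (chartField p v q)) =ᶠ[nhds p]
        ContinuousLinearMap.apply ℝ W v ∘ chartCoeff α p := by
      filter_upwards [(chartAt E p).open_source.mem_nhds hps] with q hq
      exact (chartCoeff_apply α hq v).symm
    have e' : mvfderiv 𝓘(ℝ, E) (fun q => α q (chartField p v q)) p =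
      mvfderiv 𝓘(ℝ, E) (ContinuousLinearMap.apply ℝ W v ∘ chartCoeff α p) p := e.mfderiv_eq
    rw [e', mvfderiv_comp_fderiv_apply
      (ContinuousLinearMap.apply ℝ W v).differentiableAt hA, ContinuousLinearMap.fderiv]
    rfl
  refine ⟨?_, fun w => (hB.clm_apply (hC1.clm_apply
    (differentiableAt_const w))).congr_of_eventuallyEq (hw w)⟩
  rw [hder, hder, hs.eq a b, ← hm a, ← hm b]
  have hx := extDOnFields_eq_chartField (α := α) (p := p) (fun η hη => hα.mdifferentiableAt hη)
    (mdifferentiableAt_chartField p (fderiv ℝ C z a))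
    (mdifferentiableAt_chartField p (fderiv ℝ C z b)) rfl rfl
  have hx' : extD α p (chartField p (fderiv ℝ C z a) p) (chartField p (fderiv ℝ C z b) p) =
      extDOnFields α (chartField p (fderiv ℝ C z a)) (chartField p (fderiv ℝ C z b)) p :=
    extD_apply hα (mdifferentiableAt_chartField p _) (mdifferentiableAt_chartField p _)
  rw [hx', hx, hcoef, hcoef]
  module

end Pullback

/-! ### Related vector fields, Cartan's formula, and Lie derivatives along brackets. -/

section Related

variable {E : Type*} [NormedAddCommGroup E] [NormedSpace ℝ E] [FiniteDimensional ℝ E]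
  {P : Type*} [TopologicalSpace P] [ChartedSpace E P] [IsManifold 𝓘(ℝ, E) ∞ P]
  {E' : Type*} [NormedAddCommGroup E'] [NormedSpace ℝ E'] [FiniteDimensional ℝ E']
  {M : Type*} [TopologicalSpace M] [ChartedSpace E' M] [IsManifold 𝓘(ℝ, E') ∞ M]
  {W : Type*} [NormedAddCommGroup W] [NormedSpace ℝ W]

omit [FiniteDimensional ℝ E] [IsManifold 𝓘(ℝ, E) ∞ P] [FiniteDimensional ℝ E']
  [IsManifold 𝓘(ℝ, E') ∞ M] in
theorem mvfderiv_comp_mfderiv_apply {g : M → W} {f : P → M} {p : P}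
    (hg : MDifferentiableAt 𝓘(ℝ, E') 𝓘(ℝ, W) g (f p))
    (hf : MDifferentiableAt 𝓘(ℝ, E) 𝓘(ℝ, E') f p) (u : TangentSpace 𝓘(ℝ, E) p) :
    mvfderiv 𝓘(ℝ, E) (fun q => g (f q)) p u =
      mvfderiv 𝓘(ℝ, E') g (f p) (mfderiv 𝓘(ℝ, E) 𝓘(ℝ, E') f p u) :=
  mfderiv_comp_apply p hg hf u

/-- Vector fields related by a smooth map have related brackets. -/
theorem mfderiv_mlieBracket_of_related {f : P → M} {p : P}
    (hf : ContMDiff 𝓘(ℝ, E) 𝓘(ℝ, E') ∞ f)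
    {ξ η : ∀ q : P, TangentSpace 𝓘(ℝ, E) q} {X Y : ∀ m : M, TangentSpace 𝓘(ℝ, E') m}
    (hξ : MDiffAt (T% ξ) p) (hη : MDiffAt (T% η) p)
    (hX : MDiffAt (T% X) (f p)) (hY : MDiffAt (T% Y) (f p))
    (hξX : ∀ q, mfderiv 𝓘(ℝ, E) 𝓘(ℝ, E') f q (ξ q) = X (f q))
    (hηY : ∀ q, mfderiv 𝓘(ℝ, E) 𝓘(ℝ, E') f q (η q) = Y (f q)) :
    mfderiv 𝓘(ℝ, E) 𝓘(ℝ, E') f p (mlieBracket 𝓘(ℝ, E) ξ η p) =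
      mlieBracket 𝓘(ℝ, E') X Y (f p) := by
  -- The two vectors are compared by applying the chart `φ`, viewed as a vector-valued function with
  -- injective differential; on functions both brackets act as commutators.
  set φ := extChartAt 𝓘(ℝ, E') (f p) with hφ
  have hs := mem_chart_source E' (f p)
  have hfd := hf.mdifferentiable (by simp)
  have hφs : ContMDiffAt 𝓘(ℝ, E') 𝓘(ℝ, E') ∞ φ (f p) := contMDiffAt_extChartAt
  have h1 := mvfderiv_mlieBracket (hφs.comp p hf.contMDiffAt) hξ hη
  have h2 := mvfderiv_mlieBracket hφs hX hY
  have key : ∀ (ζ : ∀ q : P, TangentSpace 𝓘(ℝ, E) q) (Z : ∀ m : M, TangentSpace 𝓘(ℝ, E') m),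
      MDiffAt (T% Z) (f p) → (∀ q, mfderiv 𝓘(ℝ, E) 𝓘(ℝ, E') f q (ζ q) = Z (f q)) →
      ∀ u, mvfderiv 𝓘(ℝ, E) (fun q => mvfderiv 𝓘(ℝ, E) (φ ∘ f) q (ζ q)) p u =
      mvfderiv 𝓘(ℝ, E') (fun m => mvfderiv 𝓘(ℝ, E') φ m (Z m)) (f p)
        (mfderiv 𝓘(ℝ, E) 𝓘(ℝ, E') f p u) := by
    intro ζ Z hZ h u
    rw [← mvfderiv_comp_mfderiv_apply (hφs.mdifferentiableAt_mvfderiv_apply hZ) (hfd p)]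
    have e : (fun q => mvfderiv 𝓘(ℝ, E) (φ ∘ f) q (ζ q)) =ᶠ[nhds p]
        fun q => mvfderiv 𝓘(ℝ, E') φ (f q) (Z (f q)) := by
      filter_upwards [hf.continuous.continuousAt.eventually
        ((chartAt E' (f p)).open_source.mem_nhds hs)] with q hq
      rw [← h q]
      exact mfderiv_comp_apply q (mdifferentiableAt_extChartAt hq) (hfd q) (ζ q)
    exact DFunLike.congr_fun (e.mfderiv_eq (I := 𝓘(ℝ, E)) (I' := 𝓘(ℝ, E'))) u
  rw [key η Y hY hηY, key ξ X hX hξX, hξX, hηY, ← h2] at h1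
  exact mvfderiv_extChartAt_injective hs
    ((mvfderiv_comp_mfderiv_apply (mdifferentiableAt_extChartAt hs) (hfd p) _).symm.trans h1)

omit [FiniteDimensional ℝ E] in
theorem extD_swap (α : ∀ p : P, TangentSpace 𝓘(ℝ, E) p →L[ℝ] W) (p : P)
    (u v : TangentSpace 𝓘(ℝ, E) p) : extD α p u v = - extD α p v u :=
  extDOnFields_swap ..

theorem isLinearMap_extD_right {α : ∀ p : P, TangentSpace 𝓘(ℝ, E) p →L[ℝ] W}
    (hα : SmoothOneForm α) (p : P) (u : TangentSpace 𝓘(ℝ, E) p) :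
    IsLinearMap ℝ (extD α p u) :=
  (TensorialAt.mkHom _ _ (extD_tensorial hα (ξ := FiberBundle.extend E u)
    (p := p))).toLinearMap.isLinear

theorem isLinearMap_extD_left {α : ∀ p : P, TangentSpace 𝓘(ℝ, E) p →L[ℝ] W}
    (hα : SmoothOneForm α) (p : P) (v : TangentSpace 𝓘(ℝ, E) p) :
    IsLinearMap ℝ (fun u => extD α p u v) where
  map_add x y := by
    simp only [extD_swap α p _ v, (isLinearMap_extD_right hα p v).map_add, neg_add]
  map_smul c x := by
    simp only [extD_swap α p _ v, (isLinearMap_extD_right hα p v).map_smul, smul_neg]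

/-- Cartan's formula for one-forms. -/
theorem lieD_eq_extD_add {α : ∀ p : P, TangentSpace 𝓘(ℝ, E) p →L[ℝ] W}
    (hα : SmoothOneForm α) {ξ : ∀ q : P, TangentSpace 𝓘(ℝ, E) q} {p : P}
    (hξ : MDiffAt (T% ξ) p) (v : TangentSpace 𝓘(ℝ, E) p) :
    lieD ξ α p v = (2 : ℝ) • extD α p (ξ p) v + mvfderiv 𝓘(ℝ, E) (fun q => α q (ξ q)) p v := by
  have h := extD_apply hα hξ (FiberBundle.mdifferentiableAt_extend 𝓘(ℝ, E) E v)
  rw [FiberBundle.extend_apply_self] at h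
  rw [h, lieD, lieDOnFields]
  module

/-- If `ℒ_κ α = 0` then `α([κ, τ]) = κ(α(τ))`. Applying this twice to `[ξ, [η, ζ]]` and `[η, [ξ,
ζ]]`, the Jacobi identity yields `α([[ξ, η], ζ]) = ξ(η(α(ζ))) - η(ξ(α(ζ))) = [ξ, η](α(ζ))`. -/
theorem lieD_lie_eq_zero {α : ∀ p : P, TangentSpace 𝓘(ℝ, E) p →L[ℝ] W}
    (hα : SmoothOneForm α) {ξ η : SmoothVF E P}
    (hξ : ∀ p v, lieD ξ α p v = 0) (hη : ∀ p v, lieD η α p v = 0)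
    (p : P) (v : TangentSpace 𝓘(ℝ, E) p) : lieD (⁅ξ, η⁆ : SmoothVF E P) α p v = 0 := by
  have : CompleteSpace E := FiniteDimensional.complete ℝ E
  have : IsManifold 𝓘(ℝ, E) (minSmoothness ℝ 3) P := by
    simpa using (inferInstance : IsManifold 𝓘(ℝ, E) 3 P)
  have : IsManifold 𝓘(ℝ, E) (((⊤ : ℕ∞) : ℕ∞ω) + 1) P := by
    simpa using (inferInstance : IsManifold 𝓘(ℝ, E) ∞ P)
  have hle : (minSmoothness ℝ 2 : ℕ∞ω) ≤ ∞ := by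
    rw [minSmoothness_of_isRCLikeNormedField, ← one_add_one_eq_two]
    exact one_add_one_le_infty
  set ζ := FiberBundle.extend E v with hζ
  have hζs : ContMDiffAt 𝓘(ℝ, E) (𝓘(ℝ, E).prod 𝓘(ℝ, E)) ∞ (T% ζ) p :=
    FiberBundle.contMDiffAt_extend 𝓘(ℝ, E) E v
  have hζd : MDiffAt (T% ζ) p := hζs.mdifferentiableAt (by simp)
  -- The second application takes place under a derivative, so the first must hold on a
  -- neighbourhood of `p`, where the extension `ζ` is known to be differentiable.
  have hζe : ∀ᶠ q in nhds p, MDiffAt (T% ζ) q := by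
    have := (contMDiffAt_iff_contMDiffAt_nhds (n := 1) (by simp)).1
      (hζs.of_le (by exact_mod_cast le_top))
    exact this.mono fun y hy => hy.mdifferentiableAt one_ne_zero
  have hb : ∀ κ : SmoothVF E P, MDiffAt (T% (mlieBracket 𝓘(ℝ, E) κ ζ)) p := fun κ =>
    (ContMDiffAt.mlieBracket_vectorField (m := ⊤) (n := ⊤) (κ.contMDiff p) hζs
      (by simp)).mdifferentiableAt (by simp)
  have hstep : ∀ κ : SmoothVF E P, (∀ p v, lieD κ α p v = 0) →
      ∀ (τ : ∀ q : P, TangentSpace 𝓘(ℝ, E) q) (q : P), MDiffAt (T% τ) q →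
      α q (mlieBracket 𝓘(ℝ, E) κ τ q) = mvfderiv 𝓘(ℝ, E) (fun r => α r (τ r)) q (κ q) := by
    intro κ hκ τ q hτ
    have h := lieD_apply hα κ hτ
    rw [hκ] at h
    exact (sub_eq_zero.1 h.symm).symm
  have hstep2 : ∀ κ κ' : SmoothVF E P, (∀ p v, lieD κ α p v = 0) → (∀ p v, lieD κ' α p v = 0) →
      α p (mlieBracket 𝓘(ℝ, E) κ (mlieBracket 𝓘(ℝ, E) κ' ζ) p) =
        mvfderiv 𝓘(ℝ, E) (fun r => mvfderiv 𝓘(ℝ, E) (fun s => α s (ζ s)) r (κ' r)) p (κ p) := by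
    intro κ κ' hκ hκ'
    rw [hstep κ hκ _ p (hb κ')]
    have e : (fun r => α r (mlieBracket 𝓘(ℝ, E) κ' ζ r)) =ᶠ[nhds p]
        fun r => mvfderiv 𝓘(ℝ, E) (fun s => α s (ζ s)) r (κ' r) := by
      filter_upwards [hζe] with q hq
      exact hstep κ' hκ' ζ q hq
    exact DFunLike.congr_fun (e.mfderiv_eq (I := 𝓘(ℝ, E)) (I' := 𝓘(ℝ, W))) _
  have hfs : ContMDiffAt 𝓘(ℝ, E) 𝓘(ℝ, W) ∞ (fun s => α s (ζ s)) p :=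
    ContMDiffAt.comp p (ContMDiff.contMDiffAt hα) hζs
  have hL := leibniz_identity_mlieBracket_apply ((ξ.contMDiff p).of_le hle)
    ((η.contMDiff p).of_le hle) (hζs.of_le hle)
  have hL' := congrArg (α p) hL
  rw [map_add, hstep2 ξ η hξ hη, hstep2 η ξ hη hξ] at hL'
  have hbr := mvfderiv_mlieBracket hfs ξ.mdifferentiableAt η.mdifferentiableAt (p := p)
  change mvfderiv 𝓘(ℝ, E) (fun s => α s (ζ s)) p (mlieBracket 𝓘(ℝ, E) ξ η p)
    - α p (mlieBracket 𝓘(ℝ, E) (mlieBracket 𝓘(ℝ, E) ξ η) ζ p) = 0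
  rw [hbr, hL']
  abel

end Related

/-! ### Curves with prescribed velocity. -/

section Curves

variable {E : Type*} [NormedAddCommGroup E] [NormedSpace ℝ E]
  {P : Type*} [TopologicalSpace P] [ChartedSpace E P] [IsManifold 𝓘(ℝ, E) ∞ P]

theorem exists_contMDiffAt_curve (p : P) (v : TangentSpace 𝓘(ℝ, E) p) :
    ∃ c : ℝ → P, c 0 = p ∧ ContMDiffAt 𝓘(ℝ, ℝ) 𝓘(ℝ, E) ∞ c 0 ∧
      ∃ c' : TangentSpace 𝓘(ℝ, ℝ) (0 : ℝ) →L[ℝ] TangentSpace 𝓘(ℝ, E) p,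
        HasMFDerivAt 𝓘(ℝ, ℝ) 𝓘(ℝ, E) c 0 c' ∧ c' (1 : ℝ) = v := by
  set φ := extChartAt 𝓘(ℝ, E) p with hφ
  set w : E := mvfderiv 𝓘(ℝ, E) φ p v with hw
  -- The curve is a straight line in the chart at `p`.
  set l : ℝ → E := fun t => φ p + t • w with hl
  have hl0 : l 0 = φ p := by simp [hl]
  have hls : ContDiff ℝ ∞ l := by fun_prop
  have hc0 : φ.symm (l 0) = p := by rw [hl0, extChartAt_to_inv]
  have hsm : ContMDiffAt 𝓘(ℝ, ℝ) 𝓘(ℝ, E) ∞ (fun t => φ.symm (l t)) 0 := by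
    have h1 : ContMDiffAt 𝓘(ℝ, E) 𝓘(ℝ, E) ∞ φ.symm (l 0) := by
      rw [hl0]
      exact (contMDiffOn_extChartAt_symm p).contMDiffAt (extChartAt_target_mem_nhds p)
    exact h1.comp (0 : ℝ) hls.contMDiff.contMDiffAt
  have hd := (hsm.mdifferentiableAt (by simp)).hasMFDerivAt
  refine ⟨fun t => φ.symm (l t), hc0, hsm, _, hd, ?_⟩
  have h1 := mfderiv_comp_apply_of_eq (0 : ℝ) (mdifferentiableAt_extChartAt (I := 𝓘(ℝ, E))
    (mem_chart_source E p)) (hsm.mdifferentiableAt (by simp)) hc0 (1 : ℝ)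
  have e : (fun t => φ (φ.symm (l t))) =ᶠ[nhds 0] l := by
    have : ∀ᶠ t in nhds (0 : ℝ), l t ∈ φ.target :=
      hls.continuous.continuousAt.eventually (by
        rw [hl0]; exact extChartAt_target_mem_nhds p)
    filter_upwards [this] with t ht
    exact φ.right_inv ht
  have h2 : mfderiv 𝓘(ℝ, ℝ) 𝓘(ℝ, E) (fun t => φ (φ.symm (l t))) 0 = fderiv ℝ l 0 := by
    rw [mfderiv_eq_fderiv, e.fderiv_eq]
  have h3 : fderiv ℝ l 0 (1 : ℝ) = w := by
    have : HasDerivAt l ((1 : ℝ) • w) 0 := ((hasDerivAt_id (0 : ℝ)).smul_const w).const_add (φ p)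
    rw [one_smul] at this
    exact this.deriv
  exact mvfderiv_extChartAt_injective (mem_chart_source E p)
    (h1.symm.trans ((DFunLike.congr_fun h2 (1 : ℝ)).trans h3))

end Curves

/-! ### The derivative of the representation. -/

section Representation

variable {EG : Type*} [NormedAddCommGroup EG] [NormedSpace ℝ EG]
  {G : Type*} [TopologicalSpace G] [ChartedSpace EG G] [Group G] [LieGroup 𝓘(ℝ, EG) ∞ G]
  {V : Type*} [NormedAddCommGroup V] [InnerProductSpace ℂ V] [CompleteSpace V]
  {T : G →* unitary (V →L[ℂ] V)}

omit [TopologicalSpace G] in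
theorem rep_mul_inv_cancel (T : G →* unitary (V →L[ℂ] V)) (g : G) :
    (T g : V →L[ℂ] V) * (T g⁻¹ : V →L[ℂ] V) = 1 := by
  rw [← Submonoid.coe_mul, ← map_mul, mul_inv_cancel, map_one, Submonoid.coe_one]

omit [TopologicalSpace G] in
theorem rep_inv_mul_cancel (T : G →* unitary (V →L[ℂ] V)) (g : G) :
    (T g⁻¹ : V →L[ℂ] V) * (T g : V →L[ℂ] V) = 1 := by
  rw [← Submonoid.coe_mul, ← map_mul, inv_mul_cancel, map_one, Submonoid.coe_one]

omit [LieGroup 𝓘(ℝ, EG) ∞ G] in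
theorem IsFaithfulSmoothRep.mdifferentiableAt (hT : IsFaithfulSmoothRep EG T) (g : G) :
    MDifferentiableAt 𝓘(ℝ, EG) 𝓘(ℝ, V →L[ℂ] V) (fun g : G => (T g : V →L[ℂ] V)) g :=
  hT.smooth.mdifferentiable (by simp) g

theorem IsFaithfulSmoothRep.mvfderiv_mulInvariantVectorField (hT : IsFaithfulSmoothRep EG T)
    (g : G) (a : GroupLieAlgebra 𝓘(ℝ, EG) G) :
    mvfderiv 𝓘(ℝ, EG) (fun g : G => (T g : V →L[ℂ] V)) g (mulInvariantVectorField a g) =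
      (T g : V →L[ℂ] V) * repDeriv EG T a := by
  have hL : MDifferentiableAt 𝓘(ℝ, EG) 𝓘(ℝ, EG) (fun h : G => g * h) 1 :=
    (contMDiff_mul_left (I := 𝓘(ℝ, EG)) (n := ∞) (a := g)).mdifferentiable (by simp) 1
  have h1 := mfderiv_comp_apply_of_eq (1 : G) (hT.mdifferentiableAt g) hL (mul_one g) a
  have e : (fun g : G => (T g : V →L[ℂ] V)) ∘ (fun h : G => g * h) =
      ContinuousLinearMap.mul ℝ (V →L[ℂ] V) (T g) ∘ fun h : G => (T h : V →L[ℂ] V) := by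
    ext1 h
    simp
  rw [e] at h1
  have h2 := mvfderiv_comp_fderiv_apply
    (ContinuousLinearMap.mul ℝ (V →L[ℂ] V) (T g)).differentiableAt (hT.mdifferentiableAt 1) a
  rw [ContinuousLinearMap.fderiv] at h2
  exact h1.symm.trans h2

/-- If `DT(e)(a) = 0`, then `T` is locally constant along an integral curve of the left-invariant
field of `a`. As `T` is injective the curve itself is constant near `0`, so its velocity `a`
vanishes. -/
theorem IsFaithfulSmoothRep.repDeriv_injective [CompleteSpace EG] (hT : IsFaithfulSmoothRep EG T) :
    Function.Injective (repDeriv EG T) := by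
  rw [injective_iff_map_eq_zero]
  intro a ha
  have h3 : (3 : ℕ∞ω) ≤ ∞ := WithTop.coe_le_coe.2 (le_top : (3 : ℕ∞) ≤ ⊤)
  have : IsManifold 𝓘(ℝ, EG) 1 G := LieGroup.toContMDiffMul (n := ∞) |>.toIsManifold |>.of_le
    (by exact_mod_cast le_top)
  have : LieGroup 𝓘(ℝ, EG) (minSmoothness ℝ 3) G := LieGroup.of_le (n := ∞) (by simpa using h3)
  obtain ⟨γ, hγ0, hγ⟩ := exists_isMIntegralCurveAt_of_contMDiffAt_boundaryless (I := 𝓘(ℝ, EG))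
    (t₀ := 0) (x₀ := (1 : G)) (v := mulInvariantVectorField (I := 𝓘(ℝ, EG)) a)
    ((contMDiff_mulInvariantVectorField (I := 𝓘(ℝ, EG)) (G := G) a).contMDiffAt.of_le (by simp))
  have hder : ∀ᶠ t in nhds (0 : ℝ),
      HasFDerivAt (fun t => (T (γ t) : V →L[ℂ] V)) (0 : ℝ →L[ℝ] (V →L[ℂ] V)) t := by
    filter_upwards [hγ] with t ht
    have h1 := ((hT.mdifferentiableAt (γ t)).hasMFDerivAt.comp t ht).hasFDerivAt
    refine h1.congr_fderiv ?_
    ext1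
    have h2 := hT.mvfderiv_mulInvariantVectorField (γ t) a
    rw [ha, mul_zero] at h2
    refine Eq.trans ?_ h2
    exact congrArg (mvfderiv 𝓘(ℝ, EG) (fun g : G => (T g : V →L[ℂ] V)) (γ t)) (one_smul ℝ _)
  obtain ⟨ε, hε, hball⟩ := Metric.eventually_nhds_iff_ball.1 hder
  have hconst : ∀ t ∈ Metric.ball (0 : ℝ) ε, γ t = 1 := by
    intro t ht
    have := IsOpen.is_const_of_fderiv_eq_zero (𝕜 := ℝ) (f := fun t => (T (γ t) : V →L[ℂ] V))
      Metric.isOpen_ball (convex_ball (0 : ℝ) ε).isPreconnected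
      (fun s hs => (hball s hs).differentiableAt.differentiableWithinAt)
      (fun s hs => (hball s hs).fderiv) ht (Metric.mem_ball_self hε)
    rw [← hγ0]
    exact hT.injective (Subtype.ext this)
  have e : γ =ᶠ[nhds 0] fun _ => (1 : G) :=
    Filter.eventually_of_mem (Metric.ball_mem_nhds 0 hε) hconst
  have h1 := hγ.hasMFDerivAt.mfderiv
  have h2 : mfderiv 𝓘(ℝ, ℝ) 𝓘(ℝ, EG) γ 0 = 0 := e.mfderiv_eq.trans mfderiv_const
  have h4 := DFunLike.congr_fun (h1.symm.trans h2) (1 : ℝ)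
  have h5 : mulInvariantVectorField (I := 𝓘(ℝ, EG)) a (γ 0) = 0 := (one_smul ℝ _).symm.trans h4
  rw [hγ0] at h5
  -- The value of the invariant field at the identity is the derivative of left translation by `1`
  -- applied to `a`, hence `a`.
  have h6 : (fun h : G => 1 * h) = id := by ext1 h; simp
  have h7 : mfderiv 𝓘(ℝ, EG) 𝓘(ℝ, EG) (fun h : G => 1 * h) 1 a = a := by
    have := congrArg (fun f : G → G => (mfderiv 𝓘(ℝ, EG) 𝓘(ℝ, EG) f 1 : EG →L[ℝ] EG) a) h6
    exact this.trans (DFunLike.congr_fun (mfderiv_id (I := 𝓘(ℝ, EG)) (x := (1 : G))) a)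
  exact h7.symm.trans h5

theorem IsFaithfulSmoothRep.mdifferentiableAt_inv (hT : IsFaithfulSmoothRep EG T) (g : G) :
    MDifferentiableAt 𝓘(ℝ, EG) 𝓘(ℝ, V →L[ℂ] V) (fun g : G => (T g⁻¹ : V →L[ℂ] V)) g :=
  (hT.mdifferentiableAt g⁻¹).comp g
    ((contMDiff_inv 𝓘(ℝ, EG) ∞ (G := G)).mdifferentiable (by simp) g)

theorem mvfderiv_mul_apply {E : Type*} [NormedAddCommGroup E] [NormedSpace ℝ E]
    {P : Type*} [TopologicalSpace P] [ChartedSpace E P]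
    {A : Type*} [NormedRing A] [NormedAlgebra ℝ A]
    {f g : P → A} {p : P} (hf : MDifferentiableAt 𝓘(ℝ, E) 𝓘(ℝ, A) f p)
    (hg : MDifferentiableAt 𝓘(ℝ, E) 𝓘(ℝ, A) g p) (u : TangentSpace 𝓘(ℝ, E) p) :
    mvfderiv 𝓘(ℝ, E) (fun q => f q * g q) p u =
      f p * mvfderiv 𝓘(ℝ, E) g p u + mvfderiv 𝓘(ℝ, E) f p u * g p :=
  DFunLike.congr_fun (hf.hasMFDerivAt.mul' hg.hasMFDerivAt).mfderiv u

theorem IsFaithfulSmoothRep.mdifferentiableAt_conj (hT : IsFaithfulSmoothRep EG T)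
    (A : V →L[ℂ] V) (g : G) :
    MDifferentiableAt 𝓘(ℝ, EG) 𝓘(ℝ, V →L[ℂ] V)
      (fun g : G => (T g⁻¹ : V →L[ℂ] V) * A * (T g : V →L[ℂ] V)) g :=
  ((hT.mdifferentiableAt_inv g).mul mdifferentiableAt_const).mul (hT.mdifferentiableAt g)

theorem IsFaithfulSmoothRep.mvfderiv_conj (hT : IsFaithfulSmoothRep EG T) (A : V →L[ℂ] V)
    (a : TangentSpace 𝓘(ℝ, EG) (1 : G)) :
    mvfderiv 𝓘(ℝ, EG) (fun g : G => (T g⁻¹ : V →L[ℂ] V) * A * (T g : V →L[ℂ] V)) 1 a =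
      A * repDeriv EG T a - repDeriv EG T a * A := by
  -- Differentiate `T(g⁻¹) T(g) = 1` at the identity.
  have hi : mvfderiv 𝓘(ℝ, EG) (fun g : G => (T g⁻¹ : V →L[ℂ] V)) 1 a = - repDeriv EG T a := by
    have h := mvfderiv_mul_apply (hT.mdifferentiableAt_inv 1) (hT.mdifferentiableAt 1) a
    simp_rw [rep_inv_mul_cancel] at h
    rw [mvfderiv_const, inv_one, map_one] at h
    simp only [zero_apply, OneMemClass.coe_one, one_mul, mul_one] at h
    exact (neg_eq_of_add_eq_zero_right h.symm).symm
  have hA : MDifferentiableAt 𝓘(ℝ, EG) 𝓘(ℝ, V →L[ℂ] V)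
      (fun g : G => (T g⁻¹ : V →L[ℂ] V) * A) 1 :=
    (hT.mdifferentiableAt_inv 1).mul mdifferentiableAt_const
  rw [mvfderiv_mul_apply hA
    (hT.mdifferentiableAt 1), mvfderiv_mul_apply (hT.mdifferentiableAt_inv 1)
    mdifferentiableAt_const, mvfderiv_const, hi, inv_one, map_one]
  simp only [zero_apply, OneMemClass.coe_one, one_mul, mul_one, mul_zero,
    zero_add]
  rw [neg_mul, ← sub_eq_add_neg]
  rfl

end Representation

/-! ### Sections, fibres and vertical vectors of a principal bundle. -/

section PrincipalBundle

variable {EG : Type*} [NormedAddCommGroup EG] [NormedSpace ℝ EG]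
  {G : Type*} [TopologicalSpace G] [ChartedSpace EG G] [Group G]
  {EM : Type*} [NormedAddCommGroup EM] [NormedSpace ℝ EM]
  {M : Type*} [TopologicalSpace M] [ChartedSpace EM M]
  {EP : Type*} [NormedAddCommGroup EP] [NormedSpace ℝ EP]
  {P : Type*} [TopologicalSpace P] [ChartedSpace EP P] [MulAction Gᵐᵒᵖ P]
  {π : P → M}

theorem act_one {G P : Type*} [Group G] [MulAction Gᵐᵒᵖ P] (p : P) : p <• (1 : G) = p := by
  rw [MulOpposite.op_one, one_smul]

namespace IsSmoothPrincipalBundle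

variable (hπ : IsSmoothPrincipalBundle EG G EM EP π)
include hπ

theorem contMDiff_right (g : G) : ContMDiff 𝓘(ℝ, EP) 𝓘(ℝ, EP) ∞ (fun q : P => q <• g) :=
  hπ.smooth_act.comp (contMDiff_id.prodMk contMDiff_const)

theorem mdifferentiableAt_right (g : G) (p : P) :
    MDifferentiableAt 𝓘(ℝ, EP) 𝓘(ℝ, EP) (fun q : P => q <• g) p :=
  (hπ.contMDiff_right g).mdifferentiable (by simp) p

theorem contMDiff_orbit (p : P) : ContMDiff 𝓘(ℝ, EG) 𝓘(ℝ, EP) ∞ (fun g : G => p <• g) :=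
  hπ.smooth_act.comp (contMDiff_const.prodMk contMDiff_id)

theorem mdifferentiableAt_orbit (p : P) (g : G) :
    MDifferentiableAt 𝓘(ℝ, EG) 𝓘(ℝ, EP) (fun g : G => p <• g) g :=
  (hπ.contMDiff_orbit p).mdifferentiable (by simp) g

theorem mdifferentiableAt_proj (p : P) : MDifferentiableAt 𝓘(ℝ, EP) 𝓘(ℝ, EM) π p :=
  hπ.smooth_proj.mdifferentiable (by simp) p

theorem mfderiv_proj_right (p : P) (g : G) (u : TangentSpace 𝓘(ℝ, EP) p) :
    mfderiv 𝓘(ℝ, EP) 𝓘(ℝ, EM) π (p <• g)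
      (mfderiv 𝓘(ℝ, EP) 𝓘(ℝ, EP) (fun q : P => q <• g) p u) =
      (mfderiv 𝓘(ℝ, EP) 𝓘(ℝ, EM) π p u : EM) := by
  have h := mfderiv_comp_apply p (hπ.mdifferentiableAt_proj (p <• g))
    (hπ.mdifferentiableAt_right g p) u
  have e : π ∘ (fun q : P => q <• g) = π := by
    ext1 q
    exact hπ.proj_act q g
  exact h.symm.trans
    (congrArg (fun f : P → M => (mfderiv 𝓘(ℝ, EP) 𝓘(ℝ, EM) f p : EP →L[ℝ] EM) u) e)

theorem mfderiv_proj_orbitDeriv (p : P) (a : TangentSpace 𝓘(ℝ, EG) (1 : G)) :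
    mfderiv 𝓘(ℝ, EP) 𝓘(ℝ, EM) π p (orbitDeriv EG G EP p a) = 0 := by
  have h := mfderiv_comp_apply_of_eq (1 : G) (hπ.mdifferentiableAt_proj p)
    (hπ.mdifferentiableAt_orbit p 1) (act_one p) a
  have e : π ∘ (fun g : G => p <• g) = fun _ => π p := by
    ext1 q
    exact hπ.proj_act p q
  have h2 := congrArg (fun f : G → M => (mfderiv 𝓘(ℝ, EG) 𝓘(ℝ, EM) f 1 : EG →L[ℝ] EM) a) e
  exact h.symm.trans (h2.trans (DFunLike.congr_fun
    (mfderiv_const (I := 𝓘(ℝ, EG)) (I' := 𝓘(ℝ, EM)) (c := π p) (x := (1 : G))) a))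

/-- Through each point of the total space passes a local section. -/
theorem exists_local_section (p : P) : ∃ s : M → P, s (π p) = p ∧
    ContMDiffAt 𝓘(ℝ, EM) 𝓘(ℝ, EP) ∞ s (π p) ∧ ∀ᶠ m in nhds (π p), π (s m) = m := by
  obtain ⟨e, hm, he1, he2, he3⟩ := hπ.locally_trivial (π p)
  have hp : p ∈ e.source := e.mem_source.2 hm
  have ht : ∀ g : G, ∀ m ∈ e.baseSet, (m, g) ∈ e.target := fun g m hm => e.mem_target.2 hm
  refine ⟨fun m => e.toOpenPartialHomeomorph.symm (m, (e p).2), ?_, ?_, ?_⟩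
  · exact e.symm_apply_mk_proj hp
  · refine ContMDiffAt.comp (π p) (he2.contMDiffAt (e.open_target.mem_nhds (ht _ _ hm)))
      (contMDiffAt_id.prodMk contMDiffAt_const)
  · filter_upwards [e.open_baseSet.mem_nhds hm] with m hm
    exact e.proj_symm_apply (ht _ _ hm)

theorem surjective_proj : Function.Surjective π := by
  intro m
  obtain ⟨e, hm, he1, he2, he3⟩ := hπ.locally_trivial m
  exact ⟨_, e.proj_symm_apply (e.mem_target.2 hm : (m, (1 : G)) ∈ e.target)⟩

/-- In a trivialization the action is right multiplication on the group coordinate, which is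
transitive. -/
theorem exists_eq_act {p q : P} (h : π q = π p) : ∃ g : G, q = p <• g := by
  obtain ⟨e, hm, he1, he2, he3⟩ := hπ.locally_trivial (π p)
  have hp : p ∈ e.source := e.mem_source.2 hm
  have hq : q ∈ e.source := e.mem_source.2 (h ▸ hm)
  refine ⟨(e p).2⁻¹ * (e q).2, ?_⟩
  have hr : p <• ((e p).2⁻¹ * (e q).2) ∈ e.source := e.mem_source.2 (by rwa [hπ.proj_act])
  refine e.injOn hq hr (Eq.trans ?_ (he3 p hp _).symm)
  exact Prod.ext ((e.coe_fst hq).trans h) (mul_inv_cancel_left _ _).symm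

theorem surjective_mfderiv_proj (p : P) :
    Function.Surjective (mfderiv 𝓘(ℝ, EP) 𝓘(ℝ, EM) π p) := by
  intro w
  obtain ⟨s, hs, hsm, hsec⟩ := hπ.exists_local_section p
  refine ⟨mfderiv 𝓘(ℝ, EM) 𝓘(ℝ, EP) s (π p) w, ?_⟩
  have h := mfderiv_comp_apply_of_eq (π p) (hπ.mdifferentiableAt_proj p)
    (hsm.mdifferentiableAt (by simp)) hs w
  have e : π ∘ s =ᶠ[nhds (π p)] id := hsec
  have h2 : mfderiv 𝓘(ℝ, EM) 𝓘(ℝ, EM) (π ∘ s) (π p) w = w := by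
    have h3 := e.mfderiv_eq (I := 𝓘(ℝ, EM)) (I' := 𝓘(ℝ, EM))
    exact (DFunLike.congr_fun h3 w).trans (DFunLike.congr_fun mfderiv_id w)
  exact h.symm.trans h2

/-- Near `p` one has `q = s(π q) k(q)` with a local section `s` through `p` and `k(p) = 1`.
Differentiating along `u` with `Dπ u = 0` kills the contribution of `s ∘ π` and leaves the
fundamental vector of `Dk(u)`. -/
theorem exists_orbitDeriv_eq [LieGroup 𝓘(ℝ, EG) ∞ G] {p : P} {u : TangentSpace 𝓘(ℝ, EP) p}
    (hu : mfderiv 𝓘(ℝ, EP) 𝓘(ℝ, EM) π p u = 0) : ∃ a, orbitDeriv EG G EP p a = u := by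
  obtain ⟨e, hm, he1, he2, he3⟩ := hπ.locally_trivial (π p)
  have hp : p ∈ e.source := e.mem_source.2 hm
  set k : P → G := fun q => (e p).2⁻¹ * (e q).2 with hk
  set s : M → P := fun m => e.toOpenPartialHomeomorph.symm (m, (e p).2) with hs
  have hsp : s (π p) = p := e.symm_apply_mk_proj hp
  have hkp : k p = 1 := by simp [hk]
  have e1 : (fun q => s (π q) <• k q) =ᶠ[nhds p] id := by
    filter_upwards [e.open_source.mem_nhds hp] with q hq
    have hq' : π q ∈ e.baseSet := e.mem_source.1 hq
    have hsq : s (π q) ∈ e.source := e.map_target (e.mem_target.2 hq')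
    have hse : e (s (π q)) = (π q, (e p).2) := e.apply_symm_apply (e.mem_target.2 hq')
    refine e.injOn (e.mem_source.2 ?_) hq ((he3 _ hsq _).trans ?_)
    · rw [hπ.proj_act]
      exact e.mem_source.1 hsq
    · rw [hse]
      refine Prod.ext ?_ (mul_inv_cancel_left _ _)
      exact (e.proj_symm_apply (e.mem_target.2 hq')).trans (e.coe_fst hq).symm
  have hkd : MDifferentiableAt 𝓘(ℝ, EP) 𝓘(ℝ, EG) k p := by
    have h1 : ContMDiffAt 𝓘(ℝ, EP) 𝓘(ℝ, EG) ∞ k p :=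
      (contMDiff_mul_left (I := 𝓘(ℝ, EG)) (n := ∞) (a := (e p).2⁻¹)).contMDiffAt.comp p
        (contMDiffAt_snd.comp p (he1.contMDiffAt (e.open_source.mem_nhds hp)))
    exact h1.mdifferentiableAt (by simp)
  have hsd : MDifferentiableAt 𝓘(ℝ, EM) 𝓘(ℝ, EP) s (π p) :=
    (ContMDiffAt.comp (π p) (he2.contMDiffAt (e.open_target.mem_nhds (e.mem_target.2 hm)))
      (contMDiffAt_id.prodMk contMDiffAt_const)).mdifferentiableAt (by simp)
  have hspd : MDifferentiableAt 𝓘(ℝ, EP) 𝓘(ℝ, EP) (fun q => s (π q)) p :=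
    hsd.comp p (hπ.mdifferentiableAt_proj p)
  have hs0 : mfderiv 𝓘(ℝ, EP) 𝓘(ℝ, EP) (fun q => s (π q)) p u = 0 := by
    refine (mfderiv_comp_apply p hsd (hπ.mdifferentiableAt_proj p) u).trans ?_
    rw [hu]
    exact map_zero _
  have hA : MDifferentiableAt (𝓘(ℝ, EP).prod 𝓘(ℝ, EG)) 𝓘(ℝ, EP)
      (fun x : P × G => x.1 <• x.2) (p, 1) := hπ.smooth_act.mdifferentiable (by simp) _
  have h1 := mfderiv_comp_apply_of_eq (x := p) (f := fun q => (s (π q), k q)) (y := (p, 1)) hA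
    (hspd.prodMk hkd) (Prod.ext hsp hkp) u
  have h2 : mfderiv 𝓘(ℝ, EP) 𝓘(ℝ, EP)
      ((fun x : P × G => x.1 <• x.2) ∘ fun q => (s (π q), k q)) p u = u :=
    (DFunLike.congr_fun (e1.mfderiv_eq (I := 𝓘(ℝ, EP)) (I' := 𝓘(ℝ, EP))) u).trans
      (DFunLike.congr_fun mfderiv_id u)
  rw [mfderiv_prodMk hspd hkd] at h1
  refine ⟨mfderiv 𝓘(ℝ, EP) 𝓘(ℝ, EG) k p u, ?_⟩
  refine Eq.trans ?_ (h1.symm.trans h2)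
  refine Eq.trans ?_ (mfderiv_prod_eq_add_apply hA).symm
  refine ((congrArg (· + _) ?_).trans (zero_add _)).symm
  exact (congrArg (mfderiv 𝓘(ℝ, EP) 𝓘(ℝ, EP) (fun z : P => z <• (1 : G)) p) hs0).trans (map_zero _)

end IsSmoothPrincipalBundle

end PrincipalBundle

/-! ### The exterior derivative of the connection form on vertical vectors. -/

section Connection

variable {EG : Type*} [NormedAddCommGroup EG] [NormedSpace ℝ EG] [FiniteDimensional ℝ EG]
  {G : Type*} [TopologicalSpace G] [ChartedSpace EG G] [Group G] [LieGroup 𝓘(ℝ, EG) ∞ G]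
  {EM : Type*} [NormedAddCommGroup EM] [NormedSpace ℝ EM] [FiniteDimensional ℝ EM]
  {M : Type*} [TopologicalSpace M] [ChartedSpace EM M] [IsManifold 𝓘(ℝ, EM) ∞ M]
  {EP : Type*} [NormedAddCommGroup EP] [NormedSpace ℝ EP] [FiniteDimensional ℝ EP]
  {P : Type*} [TopologicalSpace P] [ChartedSpace EP P] [IsManifold 𝓘(ℝ, EP) ∞ P]
  [MulAction Gᵐᵒᵖ P]
  {V : Type*} [NormedAddCommGroup V] [InnerProductSpace ℂ V] [CompleteSpace V]
  [FiniteDimensional ℂ V]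
  {π : P → M} {T : G →* unitary (V →L[ℂ] V)}
  {ϑ : ∀ p : P, TangentSpace 𝓘(ℝ, EP) p →L[ℝ] (V →L[ℂ] V)}

/-- The exterior derivative of a connection form on a fundamental vector:
`2 dϑ(a^*, v) = [ϑ(v), DT(e)(a)]`. -/
theorem two_smul_extD_orbitDeriv (hπ : IsSmoothPrincipalBundle EG G EM EP π)
    (hT : IsFaithfulSmoothRep EG T) (hϑ : IsConnectionForm (EG := EG) T ϑ) (p : P)
    (a : TangentSpace 𝓘(ℝ, EG) (1 : G)) (v : TangentSpace 𝓘(ℝ, EP) p) :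
    (2 : ℝ) • extD ϑ p (orbitDeriv EG G EP p a) v =
      ϑ p v * repDeriv EG T a - repDeriv EG T a * ϑ p v := by
  obtain ⟨c, hc0, hcs, hcv⟩ := exists_contMDiffAt_curve p v
  have : IsManifold 𝓘(ℝ, EG) ∞ G := LieGroup.toContMDiffMul.toIsManifold
  obtain ⟨γ, hγ0, hγs, hγa⟩ := exists_contMDiffAt_curve (1 : G) a
  obtain ⟨c', hc', hcv⟩ := hcv
  obtain ⟨γ', hγ', hγa⟩ := hγa
  subst hc0
  have hAs := hπ.smooth_act
  -- `ϑ` is pulled back to the plane along `(s, t) ↦ c(s) γ(t)`, where `c` has velocity `v` and `γ`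
  -- has velocity `a`. Any such `γ` will do; it need not be a one-parameter subgroup.
  set f : ℝ × ℝ → P := fun y => c y.1 <• γ y.2 with hf
  have hf0 : f 0 = c 0 := by
    change c 0 <• γ 0 = c 0
    rw [hγ0, act_one]
  have hfs : ContMDiffAt 𝓘(ℝ, ℝ × ℝ) 𝓘(ℝ, EP) ∞ f 0 := by
    have h1 : ContMDiffAt 𝓘(ℝ, ℝ × ℝ) 𝓘(ℝ, EP) ∞ (fun y : ℝ × ℝ => c y.1) 0 :=
      ContMDiffAt.comp (0 : ℝ × ℝ) (g := c) hcs contDiff_fst.contMDiff.contMDiffAt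
    have h2 : ContMDiffAt 𝓘(ℝ, ℝ × ℝ) 𝓘(ℝ, EG) ∞ (fun y : ℝ × ℝ => γ y.2) 0 :=
      ContMDiffAt.comp (0 : ℝ × ℝ) (g := γ) hγs contDiff_snd.contMDiff.contMDiffAt
    exact hAs.contMDiffAt.comp (0 : ℝ × ℝ) (h1.prodMk h2)
  have hfe : ∀ᶠ y in nhds (0 : ℝ × ℝ), MDifferentiableAt 𝓘(ℝ, ℝ × ℝ) 𝓘(ℝ, EP) f y := by
    have := (contMDiffAt_iff_contMDiffAt_nhds (n := 1) (by simp)).1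
      (hfs.of_le (by exact_mod_cast le_top))
    exact this.mono fun y hy => hy.mdifferentiableAt one_ne_zero
  -- All tangent spaces unfold to the model space, so vectors pass between points that are equal
  -- only propositionally.
  have hϑ0 : ∀ q q' : P, q = q' → ∀ u : EP, ϑ q u = ϑ q' u := by
    rintro q q' rfl u
    rfl
  have hι1 : ∀ t : ℝ, HasFDerivAt (fun s : ℝ => (s, t)) (ContinuousLinearMap.inl ℝ ℝ ℝ) 0 :=
    fun t => hasFDerivAt_prodMk_left 0 t
  have hι2 : ∀ s : ℝ, HasFDerivAt (fun t : ℝ => (s, t)) (ContinuousLinearMap.inr ℝ ℝ ℝ) 0 :=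
    fun s => hasFDerivAt_prodMk_right s 0
  have hγd : (mfderiv 𝓘(ℝ, ℝ) 𝓘(ℝ, EG) γ 0 (1 : ℝ) : EG) = a :=
    (DFunLike.congr_fun hγ'.mfderiv (1 : ℝ)).trans hγa
  -- On the line `s = 0`, equivariance determines `ϑ(∂_s f)`; its `t`-derivative at `0` is the
  -- commutator.
  have hd1 : ∀ᶠ t in nhds (0 : ℝ), ϑ (f (0, t))
      (mfderiv 𝓘(ℝ, ℝ × ℝ) 𝓘(ℝ, EP) f (0, t) ((1, 0) : ℝ × ℝ)) =
      (T (γ t)⁻¹ : V →L[ℂ] V) * ϑ (c 0) v * (T (γ t) : V →L[ℂ] V) := by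
    have hcont : Filter.Tendsto (fun t : ℝ => ((0 : ℝ), t)) (nhds 0) (nhds 0) :=
      (by fun_prop : Continuous fun t : ℝ => ((0 : ℝ), t)).tendsto' _ _ rfl
    filter_upwards [hcont.eventually hfe] with t ht
    have h1 := (ht.hasMFDerivAt.comp (0 : ℝ) (hι1 t).hasMFDerivAt).mfderiv
    have h2 := ((hπ.mdifferentiableAt_right (γ t) (c 0)).hasMFDerivAt.comp (0 : ℝ) hc').mfderiv
    have h3 := DFunLike.congr_fun (h1.symm.trans h2) (1 : ℝ)
    rw [← hϑ.equivariant, ← hcv]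
    exact congrArg (ϑ (c 0 <• γ t)) h3
  -- On the line `t = 0`, `ϑ(∂_t f)` is constant, so the other term of the exterior derivative
  -- vanishes.
  have hd2 : ∀ᶠ s in nhds (0 : ℝ), ϑ (f (s, 0))
      (mfderiv 𝓘(ℝ, ℝ × ℝ) 𝓘(ℝ, EP) f (s, 0) ((0, 1) : ℝ × ℝ)) = repDeriv EG T a := by
    have hcont : Filter.Tendsto (fun s : ℝ => (s, (0 : ℝ))) (nhds 0) (nhds 0) :=
      (by fun_prop : Continuous fun s : ℝ => (s, (0 : ℝ))).tendsto' _ _ rfl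
    filter_upwards [hcont.eventually hfe] with s hs
    have h1 := (hs.hasMFDerivAt.comp (0 : ℝ) (hι2 s).hasMFDerivAt).mfderiv
    have h2 := mfderiv_comp_apply_of_eq (0 : ℝ) (hπ.mdifferentiableAt_orbit (c s) 1)
      hγ'.mdifferentiableAt hγ0 (1 : ℝ)
    have h3 := (DFunLike.congr_fun h1.symm (1 : ℝ)).trans h2
    rw [← hϑ.orbit (c s) a, ← hγa, ← hγ'.mfderiv]
    exact (congrArg (ϑ (f (s, 0))) h3).trans
      (hϑ0 (f (s, 0)) (c s) ((congrArg (fun g => c s <• g) hγ0).trans (act_one _)) _)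
  obtain ⟨hpull, hdiff⟩ := extD_pullback hϑ.smooth hfs ((0, 1) : ℝ × ℝ) ((1, 0) : ℝ × ℝ)
  have hl1 : fderiv ℝ (fun y => ϑ (f y) (mfderiv 𝓘(ℝ, ℝ × ℝ) 𝓘(ℝ, EP) f y ((1, 0) : ℝ × ℝ))) 0
      ((0, 1) : ℝ × ℝ) = ϑ (c 0) v * repDeriv EG T a - repDeriv EG T a * ϑ (c 0) v := by
    have h1 := (HasFDerivAt.comp (0 : ℝ) (hdiff ((1, 0) : ℝ × ℝ)).hasFDerivAt (hι2 0)).fderiv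
    have h2 := mfderiv_comp_apply_of_eq (0 : ℝ) (hT.mdifferentiableAt_conj (ϑ (c 0) v) 1)
      hγ'.mdifferentiableAt hγ0 (1 : ℝ)
    replace h2 := h2.trans (congrArg (mvfderiv 𝓘(ℝ, EG) (fun g : G =>
      (T g⁻¹ : V →L[ℂ] V) * ϑ (c 0) v * (T g : V →L[ℂ] V)) 1) hγd)
    rw [← hT.mvfderiv_conj (ϑ (c 0) v) a]
    refine (DFunLike.congr_fun h1.symm (1 : ℝ)).trans (Eq.trans ?_ h2)
    rw [mfderiv_eq_fderiv]
    exact DFunLike.congr_fun (Filter.EventuallyEq.fderiv_eq hd1) (1 : ℝ)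
  have hl2 : fderiv ℝ (fun y => ϑ (f y) (mfderiv 𝓘(ℝ, ℝ × ℝ) 𝓘(ℝ, EP) f y ((0, 1) : ℝ × ℝ))) 0
      ((1, 0) : ℝ × ℝ) = 0 := by
    have h1 := (HasFDerivAt.comp (f := fun s : ℝ => (s, (0 : ℝ))) (0 : ℝ)
      (hdiff ((0, 1) : ℝ × ℝ)).hasFDerivAt (hι1 0)).fderiv
    have h2 := Filter.EventuallyEq.fderiv_eq (𝕜 := ℝ) hd2
    rw [fderiv_fun_const] at h2
    exact DFunLike.congr_fun (h1.symm.trans h2) (1 : ℝ)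
  rw [hl1, hl2, sub_zero] at hpull
  rw [← hpull]
  have hm1 : mfderiv 𝓘(ℝ, ℝ × ℝ) 𝓘(ℝ, EP) f 0 ((0, 1) : ℝ × ℝ) =
      orbitDeriv EG G EP (c 0) a := by
    have h1 := ((hfs.mdifferentiableAt (by simp)).hasMFDerivAt.comp (0 : ℝ)
      (hι2 0).hasMFDerivAt).mfderiv
    have h2 := mfderiv_comp_apply_of_eq (0 : ℝ) (hπ.mdifferentiableAt_orbit (c 0) 1)
      hγ'.mdifferentiableAt hγ0 (1 : ℝ)
    exact (DFunLike.congr_fun h1.symm (1 : ℝ)).trans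
      (h2.trans (congrArg (orbitDeriv EG G EP (c 0)) hγd))
  have hm2 : mfderiv 𝓘(ℝ, ℝ × ℝ) 𝓘(ℝ, EP) f 0 ((1, 0) : ℝ × ℝ) = (v : EP) := by
    have h1 := (HasMFDerivAt.comp (f := fun s : ℝ => (s, (0 : ℝ))) (0 : ℝ)
      (hfs.mdifferentiableAt (by simp)).hasMFDerivAt (hι1 0).hasMFDerivAt).mfderiv
    have e : f ∘ (fun s : ℝ => (s, (0 : ℝ))) = c := by
      ext1 s
      exact (congrArg (fun g => c s <• g) hγ0).trans (act_one _)
    have h2 := congrArg (fun g : ℝ → P => (mfderiv 𝓘(ℝ, ℝ) 𝓘(ℝ, EP) g 0 : ℝ →L[ℝ] EP) 1) e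
    exact (DFunLike.congr_fun h1.symm (1 : ℝ)).trans
      (h2.trans ((DFunLike.congr_fun hc'.mfderiv (1 : ℝ)).trans hcv))
  have hext : ∀ q q' : P, q = q' → ∀ u w u' w' : EP, u = u' → w = w' →
      extD ϑ q u w = extD ϑ q' u' w' := by
    rintro q q' rfl u w u' w' rfl rfl
    rfl
  exact congrArg ((2 : ℝ) • ·) (hext _ _ hf0 _ _ _ _ hm1 hm2).symm

end Connection

/-! ### The horizontal-vertical decomposition and its equivariance. -/

section Symmetries

variable {EG : Type*} [NormedAddCommGroup EG] [NormedSpace ℝ EG] [FiniteDimensional ℝ EG]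
  {G : Type*} [TopologicalSpace G] [ChartedSpace EG G] [Group G] [LieGroup 𝓘(ℝ, EG) ∞ G]
  {EM : Type*} [NormedAddCommGroup EM] [NormedSpace ℝ EM] [FiniteDimensional ℝ EM]
  {M : Type*} [TopologicalSpace M] [ChartedSpace EM M] [IsManifold 𝓘(ℝ, EM) ∞ M]
  {EP : Type*} [NormedAddCommGroup EP] [NormedSpace ℝ EP] [FiniteDimensional ℝ EP]
  {P : Type*} [TopologicalSpace P] [ChartedSpace EP P] [IsManifold 𝓘(ℝ, EP) ∞ P]
  [MulAction Gᵐᵒᵖ P]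
  {V : Type*} [NormedAddCommGroup V] [InnerProductSpace ℂ V] [CompleteSpace V]
  [FiniteDimensional ℂ V]
  {π : P → M} {T : G →* unitary (V →L[ℂ] V)}
  {ϑ : ∀ p : P, TangentSpace 𝓘(ℝ, EP) p →L[ℝ] (V →L[ℂ] V)}

/-- The inverse `A ↦ A'` is defined by choice; the linear map `ρ` agrees with it on `DT(e)(𝔤)` and
so supplies its smoothness. -/
theorem IsFaithfulSmoothRep.exists_leftInverse (hT : IsFaithfulSmoothRep EG T) :
    ∃ ρ : (V →L[ℂ] V) →L[ℝ] EG, ∀ a : TangentSpace 𝓘(ℝ, EG) (1 : G), ρ (repDeriv EG T a) = a := by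
  have : FiniteDimensional ℝ V := FiniteDimensional.complexToReal V
  have : FiniteDimensional ℝ (V →L[ℂ] V) := by
    have : FiniteDimensional ℂ (V →L[ℂ] V) := inferInstance
    exact FiniteDimensional.complexToReal (V →L[ℂ] V)
  let L : EG →ₗ[ℝ] (V →L[ℂ] V) := (repDeriv EG T).toLinearMap
  have hL : Function.Injective L := hT.repDeriv_injective
  obtain ⟨ρ, hρ⟩ := L.exists_leftInverse_of_injective (LinearMap.ker_eq_bot.2 hL)
  exact ⟨ρ.toContinuousLinearMap, fun a => LinearMap.congr_fun hρ a⟩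

theorem repDeriv_repDerivInv {A : V →L[ℂ] V} (hA : A ∈ (repDeriv EG T).range) :
    repDeriv EG T (repDerivInv EG T A) = A := by
  have h : ∃ a, repDeriv EG T a = A := hA
  rw [repDerivInv, dif_pos h]
  exact h.choose_spec

theorem IsFaithfulSmoothRep.repDerivInv_repDeriv (hT : IsFaithfulSmoothRep EG T)
    (a : TangentSpace 𝓘(ℝ, EG) (1 : G)) : repDerivInv EG T (repDeriv EG T a) = a :=
  hT.repDeriv_injective (repDeriv_repDerivInv ⟨a, rfl⟩)

theorem IsFaithfulSmoothRep.repDerivInv_zero (hT : IsFaithfulSmoothRep EG T) :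
    repDerivInv EG T 0 = 0 := by
  simpa using hT.repDerivInv_repDeriv 0

theorem IsFaithfulSmoothRep.vertVec_zero (hT : IsFaithfulSmoothRep EG T) (p : P) :
    vertVec EG EP T p 0 = 0 := by
  rw [vertVec, hT.repDerivInv_zero, map_zero]

theorem theta_vertVec (hϑ : IsConnectionForm (EG := EG) T ϑ) (p : P) {A : V →L[ℂ] V}
    (hA : A ∈ (repDeriv EG T).range) : ϑ p (vertVec EG EP T p A) = A := by
  rw [vertVec, hϑ.orbit, repDeriv_repDerivInv hA]

theorem mfderiv_proj_vertVec (hπ : IsSmoothPrincipalBundle EG G EM EP π) (p : P) (A : V →L[ℂ] V) :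
    mfderiv 𝓘(ℝ, EP) 𝓘(ℝ, EM) π p (vertVec EG EP T p A) = 0 :=
  hπ.mfderiv_proj_orbitDeriv p _

theorem theta_verPart (hϑ : IsConnectionForm (EG := EG) T ϑ) (p : P)
    (u : TangentSpace 𝓘(ℝ, EP) p) : ϑ p (verPart EG T ϑ p u) = ϑ p u :=
  theta_vertVec hϑ p (hϑ.mem_range p u)

theorem theta_horPart (hϑ : IsConnectionForm (EG := EG) T ϑ) (p : P)
    (u : TangentSpace 𝓘(ℝ, EP) p) : ϑ p (horPart EG T ϑ p u) = 0 := by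
  rw [horPart, map_sub, theta_verPart hϑ, sub_self]

theorem mfderiv_proj_horPart (hπ : IsSmoothPrincipalBundle EG G EM EP π) (p : P)
    (u : TangentSpace 𝓘(ℝ, EP) p) :
    mfderiv 𝓘(ℝ, EP) 𝓘(ℝ, EM) π p (horPart EG T ϑ p u) = mfderiv 𝓘(ℝ, EP) 𝓘(ℝ, EM) π p u := by
  rw [horPart, map_sub, verPart, mfderiv_proj_vertVec hπ, sub_zero]

theorem horPart_eq_self (hT : IsFaithfulSmoothRep EG T) {p : P} {u : TangentSpace 𝓘(ℝ, EP) p}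
    (hu : ϑ p u = 0) : horPart EG T ϑ p u = u := by
  rw [horPart, verPart, hu, hT.vertVec_zero, sub_zero]

/-- A tangent vector is determined by its value under the connection form and its projection. -/
theorem eq_of_theta_eq_of_proj_eq (hπ : IsSmoothPrincipalBundle EG G EM EP π)
    (hT : IsFaithfulSmoothRep EG T) (hϑ : IsConnectionForm (EG := EG) T ϑ) {p : P}
    {u v : TangentSpace 𝓘(ℝ, EP) p} (h1 : ϑ p u = ϑ p v)
    (h2 : mfderiv 𝓘(ℝ, EP) 𝓘(ℝ, EM) π p u = mfderiv 𝓘(ℝ, EP) 𝓘(ℝ, EM) π p v) : u = v := by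
  -- The difference is vertical, hence fundamental for some `a`, and `ϑ` sends it to `DT(e)(a) = 0`.
  obtain ⟨a, ha⟩ := hπ.exists_orbitDeriv_eq (p := p) (u := u - v) (by rw [map_sub, h2, sub_self])
  have h3 : repDeriv EG T a = 0 := by rw [← hϑ.orbit p a, ha, map_sub, h1, sub_self]
  rw [hT.repDeriv_injective (h3.trans (map_zero _).symm), map_zero] at ha
  exact sub_eq_zero.1 ha.symm

theorem horLift_spec (hπ : IsSmoothPrincipalBundle EG G EM EP π)
    (hϑ : IsConnectionForm (EG := EG) T ϑ) (p : P) (w : TangentSpace 𝓘(ℝ, EM) (π p)) :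
    ϑ p (horLift π ϑ p w) = 0 ∧ mfderiv 𝓘(ℝ, EP) 𝓘(ℝ, EM) π p (horLift π ϑ p w) = w := by
  have h : ∃ u : TangentSpace 𝓘(ℝ, EP) p,
      ϑ p u = 0 ∧ mfderiv 𝓘(ℝ, EP) 𝓘(ℝ, EM) π p u = w := by
    obtain ⟨u, hu⟩ := hπ.surjective_mfderiv_proj p w
    exact ⟨horPart EG T ϑ p u, theta_horPart hϑ p u, (mfderiv_proj_horPart hπ p u).trans hu⟩
  rw [horLift, dif_pos h]
  exact h.choose_spec

theorem horLift_eq (hπ : IsSmoothPrincipalBundle EG G EM EP π)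
    (hT : IsFaithfulSmoothRep EG T) (hϑ : IsConnectionForm (EG := EG) T ϑ) {p : P}
    {u : TangentSpace 𝓘(ℝ, EP) p} {w : TangentSpace 𝓘(ℝ, EM) (π p)} (h1 : ϑ p u = 0)
    (h2 : mfderiv 𝓘(ℝ, EP) 𝓘(ℝ, EM) π p u = w) : horLift π ϑ p w = u :=
  have h := horLift_spec hπ hϑ p w
  eq_of_theta_eq_of_proj_eq hπ hT hϑ (h.1.trans h1.symm) (h.2.trans h2.symm)

/-- Every element of `DT(e)(𝔤)` is a value of `ϑ` at `p`, and equivariance makes its conjugate a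
value at `p g`. -/
theorem conj_mem_range (hϑ : IsConnectionForm (EG := EG) T ϑ) (p : P) (g : G) {A : V →L[ℂ] V}
    (hA : A ∈ (repDeriv EG T).range) :
    (T g⁻¹ : V →L[ℂ] V) * A * (T g : V →L[ℂ] V) ∈ (repDeriv EG T).range := by
  have h := hϑ.equivariant p g (vertVec EG EP T p A)
  rw [theta_vertVec hϑ p hA] at h
  rw [← h]
  exact hϑ.mem_range _ _

theorem vertVec_act (hπ : IsSmoothPrincipalBundle EG G EM EP π)
    (hT : IsFaithfulSmoothRep EG T) (hϑ : IsConnectionForm (EG := EG) T ϑ) (p : P) (g : G)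
    {A : V →L[ℂ] V} (hA : A ∈ (repDeriv EG T).range) :
    vertVec EG EP T (p <• g) ((T g⁻¹ : V →L[ℂ] V) * A * (T g : V →L[ℂ] V)) =
      mfderiv 𝓘(ℝ, EP) 𝓘(ℝ, EP) (fun q : P => q <• g) p (vertVec EG EP T p A) := by
  refine eq_of_theta_eq_of_proj_eq hπ hT hϑ ?_ ?_
  · rw [theta_vertVec hϑ _ (conj_mem_range hϑ p g hA), hϑ.equivariant, theta_vertVec hϑ p hA]
  · rw [mfderiv_proj_vertVec hπ]
    exact ((hπ.mfderiv_proj_right p g _).trans (mfderiv_proj_vertVec hπ p A)).symm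

theorem horLift_act (hπ : IsSmoothPrincipalBundle EG G EM EP π)
    (hT : IsFaithfulSmoothRep EG T) (hϑ : IsConnectionForm (EG := EG) T ϑ)
    (X : ∀ m : M, TangentSpace 𝓘(ℝ, EM) m) (p : P) (g : G) :
    horLift π ϑ (p <• g) (X (π (p <• g))) =
      mfderiv 𝓘(ℝ, EP) 𝓘(ℝ, EP) (fun q : P => q <• g) p (horLift π ϑ p (X (π p))) := by
  have h := horLift_spec hπ hϑ p (X (π p))
  refine horLift_eq hπ hT hϑ ?_ ?_
  · rw [hϑ.equivariant, h.1, mul_zero, zero_mul]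
  · have hX : ∀ m m' : M, m = m' → (X m : EM) = X m' := by
      rintro m m' rfl
      rfl
    exact ((hπ.mfderiv_proj_right p g _).trans h.2).trans (hX _ _ (hπ.proj_act p g).symm)

/-- The derivative of an equivariant function along a fundamental vector. -/
theorem mvfderiv_orbitDeriv (hπ : IsSmoothPrincipalBundle EG G EM EP π)
    (hT : IsFaithfulSmoothRep EG T) {F : P → (V →L[ℂ] V)} (hF : F ∈ equivFunctions EG EP P T)
    (p : P) (a : TangentSpace 𝓘(ℝ, EG) (1 : G)) :
    mvfderiv 𝓘(ℝ, EP) F p (orbitDeriv EG G EP p a) =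
      F p * repDeriv EG T a - repDeriv EG T a * F p := by
  have h := mfderiv_comp_apply_of_eq (1 : G) (hF.1.mdifferentiable (by simp) p)
    (hπ.mdifferentiableAt_orbit p 1) (act_one p) a
  have e : F ∘ (fun g : G => p <• g) =
      fun g : G => (T g⁻¹ : V →L[ℂ] V) * F p * (T g : V →L[ℂ] V) := by
    ext1 g
    exact hF.2.2 p g
  rw [e] at h
  exact h.symm.trans (hT.mvfderiv_conj (F p) a)

/-- The projection `L ∘ ρ` fixes `F`, so differentiating `L ∘ ρ ∘ F = F` puts the derivative in the
range of `L`. -/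
theorem mvfderiv_mem_range (hT : IsFaithfulSmoothRep EG T) {F : P → (V →L[ℂ] V)}
    (hF : ContMDiff 𝓘(ℝ, EP) 𝓘(ℝ, V →L[ℂ] V) ∞ F) (hr : ∀ p, F p ∈ (repDeriv EG T).range)
    (p : P) (u : TangentSpace 𝓘(ℝ, EP) p) :
    mvfderiv 𝓘(ℝ, EP) F p u ∈ (repDeriv EG T).range := by
  obtain ⟨ρ, hρ⟩ := hT.exists_leftInverse
  let L : EG →L[ℝ] (V →L[ℂ] V) := repDeriv EG T
  have e : (L ∘L ρ) ∘ F = F := by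
    ext1 q
    obtain ⟨a, ha⟩ := hr q
    have h1 : ρ (F q) = a := by rw [← hρ a]; exact congrArg ρ ha.symm
    exact (congrArg L h1).trans ha
  have h := mvfderiv_comp_fderiv_apply (L ∘L ρ).differentiableAt (hF.mdifferentiable (by simp) p) u
  rw [e, ContinuousLinearMap.fderiv] at h
  rw [h]
  exact ⟨ρ _, rfl⟩

/-- A smooth family of fundamental vectors is a smooth vector field. -/
theorem IsSmoothPrincipalBundle.contMDiff_orbitDeriv (hπ : IsSmoothPrincipalBundle EG G EM EP π)
    {A : P → EG} (hA : ContMDiff 𝓘(ℝ, EP) 𝓘(ℝ, EG) ∞ A) :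
    ContMDiff 𝓘(ℝ, EP) 𝓘(ℝ, EP).tangent ∞
      (fun p => TotalSpace.mk' EP p (orbitDeriv EG G EP p (A p))) := by
  have hG : IsManifold 𝓘(ℝ, EG) ∞ G := inferInstance
  have h1 : ContMDiff 𝓘(ℝ, EP) 𝓘(ℝ, EP).tangent ∞
      (fun p : P => (TotalSpace.mk' EP p 0 : TangentBundle 𝓘(ℝ, EP) P)) :=
    Bundle.contMDiff_zeroSection ℝ (TangentSpace 𝓘(ℝ, EP) : P → Type _)
  have h2 : ContMDiff 𝓘(ℝ, EP) 𝓘(ℝ, EG).tangent ∞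
      (fun p : P => (TotalSpace.mk' EG 1 (A p) : TangentBundle 𝓘(ℝ, EG) G)) := by
    intro p
    rw [Bundle.contMDiffAt_totalSpace]
    refine ⟨contMDiffAt_const, ?_⟩
    let e := trivializationAt EG (TangentSpace 𝓘(ℝ, EG) : G → Type _) 1
    let L : EG →L[ℝ] EG := e.continuousLinearMapAt ℝ 1
    have h : ContMDiffAt 𝓘(ℝ, EP) 𝓘(ℝ, EG) ∞ (fun q => L (A q)) p :=
      L.contMDiff.contMDiffAt.comp p hA.contMDiffAt
    refine h.congr_of_eventuallyEq (Filter.Eventually.of_forall fun q => ?_)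
    refine (?_ : _ = e.continuousLinearMapAt ℝ 1 (A q))
    exact (congrFun (e.coe_linearMapAt_of_mem (R := ℝ)
      (FiberBundle.mem_baseSet_trivializationAt' (1 : G))) (A q)).symm
  have h3 : ContMDiff (𝓘(ℝ, EP).prod 𝓘(ℝ, EG)).tangent 𝓘(ℝ, EP).tangent ∞
      (tangentMap (𝓘(ℝ, EP).prod 𝓘(ℝ, EG)) 𝓘(ℝ, EP) (fun x : P × G => x.1 <• x.2)) :=
    hπ.smooth_act.contMDiff_tangentMap (by simp)
  -- A fundamental vector is the tangent map of the action applied to the zero vector at `p` and a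
  -- vector at the identity.
  have h4 := (h3.comp contMDiff_equivTangentBundleProd_symm).comp (h1.prodMk h2)
  have hm : ∀ q q' : P, q = q' → ∀ u u' : EP, u = u' →
      (TotalSpace.mk' EP q u : TangentBundle 𝓘(ℝ, EP) P) = TotalSpace.mk' EP q' u' := by
    rintro q _ rfl u _ rfl
    rfl
  convert h4 using 1
  ext1 p
  refine hm _ _ (act_one p).symm _ _ ?_
  have h5 := mfderiv_prod_eq_add_apply (p := (p, (1 : G)))
    (hπ.smooth_act.mdifferentiable (by simp) (p, 1)) (v := ((0 : EP), (A p : EG)))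
  refine Eq.trans ?_ h5.symm
  refine ((congrArg (· + _) (map_zero _)).trans (zero_add _)).symm

theorem IsSmoothPrincipalBundle.contMDiff_vertVec (hπ : IsSmoothPrincipalBundle EG G EM EP π)
    (hT : IsFaithfulSmoothRep EG T) {F : P → (V →L[ℂ] V)}
    (hF : ContMDiff 𝓘(ℝ, EP) 𝓘(ℝ, V →L[ℂ] V) ∞ F) (hr : ∀ p, F p ∈ (repDeriv EG T).range) :
    ContMDiff 𝓘(ℝ, EP) 𝓘(ℝ, EP).tangent ∞
      (fun p => TotalSpace.mk' EP p (vertVec EG EP T p (F p))) := by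
  obtain ⟨ρ, hρ⟩ := hT.exists_leftInverse
  have h : ∀ p, repDerivInv EG T (F p) = ρ (F p) := fun p => by
    obtain ⟨a, ha⟩ := hr p
    have ha' : repDeriv EG T a = F p := ha
    rw [← ha', hT.repDerivInv_repDeriv, hρ]
  have h2 := hπ.contMDiff_orbitDeriv (ρ.contMDiff.comp hF)
  refine h2.congr fun p => ?_
  exact congrArg (fun a => (TotalSpace.mk' EP p (orbitDeriv EG G EP p a))) (h p)

theorem extD_orbitDeriv_of_theta_eq_zero (hπ : IsSmoothPrincipalBundle EG G EM EP π)
    (hT : IsFaithfulSmoothRep EG T) (hϑ : IsConnectionForm (EG := EG) T ϑ) {p : P}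
    (a : TangentSpace 𝓘(ℝ, EG) (1 : G)) {v : TangentSpace 𝓘(ℝ, EP) p} (hv : ϑ p v = 0) :
    extD ϑ p (orbitDeriv EG G EP p a) v = 0 := by
  have h := two_smul_extD_orbitDeriv hπ hT hϑ p a v
  rw [hv, zero_mul, mul_zero, sub_zero] at h
  exact (smul_eq_zero.1 h).resolve_left two_ne_zero

theorem horPart_add_verPart (p : P) (u : TangentSpace 𝓘(ℝ, EP) p) :
    horPart EG T ϑ p u + verPart EG T ϑ p u = u :=
  sub_add_cancel _ _

/-! ### Infinitesimal symmetries in terms of curvature and covariant differential. -/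

/-- The function `-ϑ(ξ)` of an invariant vector field is equivariant. -/
theorem neg_theta_mem_equivFunctions (hϑ : IsConnectionForm (EG := EG) T ϑ) {ξ : SmoothVF EP P}
    (hξ : ξ ∈ invariantFields G EP P) : (fun p => -ϑ p (ξ p)) ∈ equivFunctions EG EP P T := by
  refine ⟨(ContMDiff.comp hϑ.smooth ξ.contMDiff).neg, fun p => neg_mem (hϑ.mem_range p _),
    fun p g => ?_⟩
  beta_reduce
  rw [hξ p g, hϑ.equivariant, mul_neg, neg_mul]

/-- The Lie derivative of the connection form along an invariant vector field. -/
theorem lieD_theta_eq (hπ : IsSmoothPrincipalBundle EG G EM EP π)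
    (hT : IsFaithfulSmoothRep EG T) (hϑ : IsConnectionForm (EG := EG) T ϑ) {ξ : SmoothVF EP P}
    (hξ : ξ ∈ invariantFields G EP P) (p : P) (v : TangentSpace 𝓘(ℝ, EP) p) :
    lieD ξ ϑ p v = (2 : ℝ) • curvature EG T ϑ p (ξ p) v
      - covDFun EG T ϑ (fun q => -ϑ q (ξ q)) p v := by
  have hF := neg_theta_mem_equivFunctions hϑ hξ
  have hneg : ∀ w : TangentSpace 𝓘(ℝ, EP) p, mvfderiv 𝓘(ℝ, EP) (fun q => ϑ q (ξ q)) p w =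
      -mvfderiv 𝓘(ℝ, EP) (fun q => -ϑ q (ξ q)) p w := fun w => by
    have h : mvfderiv 𝓘(ℝ, EP) (fun q => -ϑ q (ξ q)) p =
        -mvfderiv 𝓘(ℝ, EP) (fun q => ϑ q (ξ q)) p := mvfderiv_fun_neg
    rw [h, neg_apply, neg_neg]
  have hr := isLinearMap_extD_right hϑ.smooth p (ξ p)
  have hl := isLinearMap_extD_left hϑ.smooth p (horPart EG T ϑ p v)
  rw [lieD_eq_extD_add hϑ.smooth ξ.mdifferentiableAt, hneg, curvature, covDFun, ← sub_eq_add_neg]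
  set F : P → (V →L[ℂ] V) := fun q => -ϑ q (ξ q) with hFd
  have hv := horPart_add_verPart (EG := EG) (T := T) (ϑ := ϑ) p v
  have hx := horPart_add_verPart (EG := EG) (T := T) (ϑ := ϑ) p (ξ p)
  -- Against a horizontal vector `dϑ` does not see the vertical part of `ξ`, so this is the
  -- curvature.
  have h1 : extD ϑ p (ξ p) (horPart EG T ϑ p v) =
      extD ϑ p (horPart EG T ϑ p (ξ p)) (horPart EG T ϑ p v) := by
    have h := hl.map_add (horPart EG T ϑ p (ξ p)) (verPart EG T ϑ p (ξ p))
    rw [hx] at h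
    rw [h, verPart, vertVec,
      extD_orbitDeriv_of_theta_eq_zero hπ hT hϑ _ (theta_horPart hϑ p v), add_zero]
  -- In vertical directions `2 dϑ(ξ, ·)` and `dF` are the same commutator and cancel.
  have h2 : (2 : ℝ) • extD ϑ p (ξ p) (verPart EG T ϑ p v) =
      mvfderiv 𝓘(ℝ, EP) F p (verPart EG T ϑ p v) := by
    rw [verPart, vertVec, extD_swap, smul_neg, two_smul_extD_orbitDeriv hπ hT hϑ,
      mvfderiv_orbitDeriv hπ hT hF]
    simp only [hFd, neg_mul, mul_neg]
    abel
  have h3 := hr.map_add (horPart EG T ϑ p v) (verPart EG T ϑ p v)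
  have h4 := map_add (mvfderiv 𝓘(ℝ, EP) F p) (horPart EG T ϑ p v) (verPart EG T ϑ p v)
  rw [hv] at h3 h4
  rw [h3, h4, smul_add, h2, h1]
  abel

theorem mem_setE_iff (hπ : IsSmoothPrincipalBundle EG G EM EP π)
    (hT : IsFaithfulSmoothRep EG T) (hϑ : IsConnectionForm (EG := EG) T ϑ) {ξ : SmoothVF EP P}
    (hξ : ξ ∈ invariantFields G EP P) : ξ ∈ setE G ϑ ↔ ∀ p v,
      (2 : ℝ) • curvature EG T ϑ p (ξ p) v = covDFun EG T ϑ (fun q => -ϑ q (ξ q)) p v := by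
  refine (and_iff_right hξ).trans (forall₂_congr fun p v => ?_)
  rw [lieD_theta_eq hπ hT hϑ hξ, sub_eq_zero]

theorem horLift_eq_horPart (hπ : IsSmoothPrincipalBundle EG G EM EP π)
    (hT : IsFaithfulSmoothRep EG T) (hϑ : IsConnectionForm (EG := EG) T ϑ) {p : P}
    {u : TangentSpace 𝓘(ℝ, EP) p} {w : TangentSpace 𝓘(ℝ, EM) (π p)}
    (h : mfderiv 𝓘(ℝ, EP) 𝓘(ℝ, EM) π p u = w) : horLift π ϑ p w = horPart EG T ϑ p u :=
  horLift_eq hπ hT hϑ (theta_horPart hϑ p u) ((mfderiv_proj_horPart hπ p u).trans h)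

theorem horPart_horLift (hπ : IsSmoothPrincipalBundle EG G EM EP π)
    (hT : IsFaithfulSmoothRep EG T) (hϑ : IsConnectionForm (EG := EG) T ϑ) (p : P)
    (w : TangentSpace 𝓘(ℝ, EM) (π p)) :
    horPart EG T ϑ p (horLift π ϑ p w) = horLift π ϑ p w :=
  horPart_eq_self hT (horLift_spec hπ hϑ p w).1

theorem curvature_horLift (hπ : IsSmoothPrincipalBundle EG G EM EP π)
    (hT : IsFaithfulSmoothRep EG T) (hϑ : IsConnectionForm (EG := EG) T ϑ) {p : P}
    {u : TangentSpace 𝓘(ℝ, EP) p} {w : TangentSpace 𝓘(ℝ, EM) (π p)}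
    (h : mfderiv 𝓘(ℝ, EP) 𝓘(ℝ, EM) π p u = w) (v : TangentSpace 𝓘(ℝ, EP) p) :
    curvature EG T ϑ p (horLift π ϑ p w) v = curvature EG T ϑ p u v := by
  rw [curvature, curvature, horPart_horLift hπ hT hϑ, horLift_eq_horPart hπ hT hϑ h]

/-- An invariant vector field on the total space projects to the base. -/
theorem exists_mfderiv_proj_eq (hπ : IsSmoothPrincipalBundle EG G EM EP π) {ξ : SmoothVF EP P}
    (hξ : ξ ∈ invariantFields G EP P) :
    ∃ X : SmoothVF EM M, ∀ p, mfderiv 𝓘(ℝ, EP) 𝓘(ℝ, EM) π p (ξ p) = X (π p) := by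
  choose r hr using hπ.surjective_proj
  let X : ∀ m : M, TangentSpace 𝓘(ℝ, EM) m := fun m =>
    (mfderiv 𝓘(ℝ, EP) 𝓘(ℝ, EM) π (r m) (ξ (r m)) : EM)
  have hX : ∀ p, mfderiv 𝓘(ℝ, EP) 𝓘(ℝ, EM) π p (ξ p) = X (π p) := fun p => by
    -- The chosen point of the fibre differs from `p` by some `g`, and by invariance the projected
    -- vectors agree.
    obtain ⟨g, hg⟩ := hπ.exists_eq_act (hr (π p))
    have h : ∀ q : P, q = p <• g → (mfderiv 𝓘(ℝ, EP) 𝓘(ℝ, EM) π q (ξ q) : EM) =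
        mfderiv 𝓘(ℝ, EP) 𝓘(ℝ, EM) π (p <• g) (ξ (p <• g)) := by
      rintro q rfl
      rfl
    exact ((h _ hg).trans ((congrArg (mfderiv 𝓘(ℝ, EP) 𝓘(ℝ, EM) π (p <• g)) (hξ p g)).trans
      (hπ.mfderiv_proj_right p g (ξ p)))).symm
  refine ⟨⟨X, fun m => ?_⟩, hX⟩
  obtain ⟨p, rfl⟩ := hπ.surjective_proj m
  obtain ⟨s, hs, hsm, hsec⟩ := hπ.exists_local_section p
  have h1 : ContMDiff 𝓘(ℝ, EP).tangent 𝓘(ℝ, EM).tangent ∞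
      (tangentMap 𝓘(ℝ, EP) 𝓘(ℝ, EM) π) := hπ.smooth_proj.contMDiff_tangentMap (by simp)
  have h2 := (h1.comp ξ.contMDiff).contMDiffAt.comp (π p) hsm
  refine h2.congr_of_eventuallyEq ?_
  filter_upwards [hsec] with m hm
  have h : ∀ m' : M, m' = m → ∀ u : EM, u = X m' →
      (TotalSpace.mk' EM m (X m) : TangentBundle 𝓘(ℝ, EM) M) = TotalSpace.mk' EM m' u := by
    rintro m' rfl u rfl
    rfl
  exact h _ hm _ (hX (s m))

/-- Transport of a Lie algebra structure along a bijection. -/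
theorem Equiv.exists_lieAlgebra {R L S : Type*} [CommRing R] [LieRing L] [LieAlgebra R L]
    (e : L ≃ S) : ∃ (_ : LieRing S) (_ : LieAlgebra R S) (f : L ≃ₗ⁅R⁆ S), ∀ x, f x = e x :=
  letI := e.symm.lieRing
  letI := e.symm.lieAlgebra R
  ⟨inferInstance, inferInstance, (e.symm.lieEquiv R).symm, fun _ => rfl⟩

theorem eq_of_apply_proj_eq (hπ : IsSmoothPrincipalBundle EG G EM EP π) {X Y : SmoothVF EM M}
    (h : ∀ p, X (π p) = Y (π p)) : X = Y := by
  ext m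
  obtain ⟨p, rfl⟩ := hπ.surjective_proj m
  exact h p

theorem mk_mem_setF (hπ : IsSmoothPrincipalBundle EG G EM EP π)
    (hT : IsFaithfulSmoothRep EG T) (hϑ : IsConnectionForm (EG := EG) T ϑ) {ξ : SmoothVF EP P}
    (hξ : ξ ∈ setE G ϑ) {X : SmoothVF EM M}
    (hX : ∀ p, mfderiv 𝓘(ℝ, EP) 𝓘(ℝ, EM) π p (ξ p) = X (π p)) :
    ((fun p => -ϑ p (ξ p)), X) ∈ setF EG EM π T ϑ := by
  refine ⟨neg_theta_mem_equivFunctions hϑ hξ.1, ⟨ξ, hξ, hX⟩, fun p v => ?_⟩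
  rw [interiorProd, curvature_horLift hπ hT hϑ (hX p)]
  exact (mem_setE_iff hπ hT hϑ hξ.1).1 hξ p v

/-- The field is `X^* - F^*`. As `X` lies in `ℋ_G^0` it is the projection of some `ξ` in `ℰ_G^0`,
and `X^*` is smooth because it is `ξ` minus its vertical part. -/
theorem exists_mem_setE (hπ : IsSmoothPrincipalBundle EG G EM EP π)
    (hT : IsFaithfulSmoothRep EG T) (hϑ : IsConnectionForm (EG := EG) T ϑ)
    {a : (P → (V →L[ℂ] V)) × SmoothVF EM M} (ha : a ∈ setF EG EM π T ϑ) :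
    ∃ ζ ∈ setE G ϑ, (∀ p, -ϑ p (ζ p) = a.1 p) ∧
      ∀ p, mfderiv 𝓘(ℝ, EP) 𝓘(ℝ, EM) π p (ζ p) = a.2 (π p) := by
  obtain ⟨F, X⟩ := a
  obtain ⟨hF, ⟨ξ, hξ, hX⟩, hFX⟩ := ha
  let ζ₀ : ∀ p : P, TangentSpace 𝓘(ℝ, EP) p := fun p =>
    horLift π ϑ p (X (π p)) - vertVec EG EP T p (F p)
  have hζ₀ : ContMDiff 𝓘(ℝ, EP) 𝓘(ℝ, EP).tangent ∞
      (fun p => (TotalSpace.mk' EP p (ζ₀ p) : TangentBundle 𝓘(ℝ, EP) P)) := by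
    have hξr : ContMDiff 𝓘(ℝ, EP) 𝓘(ℝ, V →L[ℂ] V) ∞ (fun p => ϑ p (ξ p)) :=
      ContMDiff.comp hϑ.smooth ξ.contMDiff
    have h1 := hπ.contMDiff_vertVec hT hξr (fun p => hϑ.mem_range p _)
    have h2 := hπ.contMDiff_vertVec hT hF.1 hF.2.1
    refine ((ξ.contMDiff.sub_section h1).sub_section h2).congr fun p => ?_
    have h3 := horLift_eq_horPart hπ hT hϑ (hX p)
    exact congrArg (fun u => (TotalSpace.mk' EP p (u - vertVec EG EP T p (F p)) :
      TangentBundle 𝓘(ℝ, EP) P)) h3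
  let ζ : SmoothVF EP P := ⟨ζ₀, hζ₀⟩
  have hζ : ∀ p, ζ p = horLift π ϑ p (X (π p)) - vertVec EG EP T p (F p) := fun p => rfl
  have h1 : ∀ p, -ϑ p (ζ p) = F p := fun p => by
    rw [hζ, map_sub, (horLift_spec hπ hϑ p _).1, theta_vertVec hϑ p (hF.2.1 p), zero_sub, neg_neg]
  have h2 : ∀ p, mfderiv 𝓘(ℝ, EP) 𝓘(ℝ, EM) π p (ζ p) = X (π p) := fun p => by
    rw [hζ, map_sub, (horLift_spec hπ hϑ p _).2, mfderiv_proj_vertVec hπ, sub_zero]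
  have hi : ζ ∈ invariantFields G EP P := fun p g => by
    have hFg : F (p <• g) = _ := hF.2.2 p g
    rw [hζ, hζ, map_sub, horLift_act hπ hT hϑ, hFg, vertVec_act hπ hT hϑ p g (hF.2.1 p)]
  refine ⟨ζ, (mem_setE_iff hπ hT hϑ hi).2 fun p v => ?_, h1, h2⟩
  rw [funext h1, ← curvature_horLift hπ hT hϑ (h2 p)]
  exact hFX p v

/-! ### Closure under the Lie algebra operations. -/

theorem add_mem_setE (hϑ : SmoothOneForm ϑ) {ξ η : SmoothVF EP P} (hξ : ξ ∈ setE G ϑ)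
    (hη : η ∈ setE G ϑ) : ξ + η ∈ setE G ϑ := by
  refine ⟨fun p g => ?_, fun p v => ?_⟩
  · have h := map_add (mfderiv 𝓘(ℝ, EP) 𝓘(ℝ, EP) (fun q : P => q <• g) p) (ξ p) (η p)
    exact (congrArg₂ (· + ·) (hξ.1 p g) (hη.1 p g)).trans h.symm
  · have h1 := hξ.2 p v
    have h2 := hη.2 p v
    rw [lieD_eq_extD_add hϑ (ContMDiffSection.mdifferentiableAt _)] at h1 h2 ⊢
    have h3 : mvfderiv 𝓘(ℝ, EP) (fun q => ϑ q ((ξ + η) q)) p =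
        mvfderiv 𝓘(ℝ, EP) (fun q => ϑ q (ξ q)) p + mvfderiv 𝓘(ℝ, EP) (fun q => ϑ q (η q)) p := by
      rw [← mvfderiv_fun_add (hϑ.mdifferentiableAt ξ.mdifferentiableAt)
        (hϑ.mdifferentiableAt η.mdifferentiableAt)]
      congr 1
      ext1 q
      exact map_add (ϑ q) _ _
    have h4 : extD ϑ p ((ξ + η) p) v = extD ϑ p (ξ p) v + extD ϑ p (η p) v :=
      (isLinearMap_extD_left hϑ p v).map_add _ _
    rw [h3, h4, add_apply, smul_add, add_add_add_comm, h1, h2, add_zero]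

theorem smul_mem_setE (hϑ : SmoothOneForm ϑ) (c : ℝ) {ξ : SmoothVF EP P} (hξ : ξ ∈ setE G ϑ) :
    c • ξ ∈ setE G ϑ := by
  refine ⟨fun p g => ?_, fun p v => ?_⟩
  · have h := map_smul (mfderiv 𝓘(ℝ, EP) 𝓘(ℝ, EP) (fun q : P => q <• g) p) c (ξ p)
    exact (congrArg (c • ·) (hξ.1 p g)).trans h.symm
  · have h1 := hξ.2 p v
    rw [lieD_eq_extD_add hϑ (ContMDiffSection.mdifferentiableAt _)] at h1 ⊢
    have h3 : mvfderiv 𝓘(ℝ, EP) (fun q => ϑ q ((c • ξ) q)) p =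
        c • mvfderiv 𝓘(ℝ, EP) (fun q => ϑ q (ξ q)) p := by
      have h : (fun q => ϑ q ((c • ξ) q)) = c • fun q => ϑ q (ξ q) :=
        funext fun q => map_smul (ϑ q) c _
      rw [h]
      exact const_smul_mfderiv (hϑ.mdifferentiableAt ξ.mdifferentiableAt) c
    have h4 : extD ϑ p ((c • ξ) p) v = c • extD ϑ p (ξ p) v :=
      (isLinearMap_extD_left hϑ p v).map_smul _ _
    rw [h3, h4, smul_apply, smul_comm, ← smul_add, h1, smul_zero]

theorem zero_mem_setE (hϑ : SmoothOneForm ϑ) : (0 : SmoothVF EP P) ∈ setE G ϑ := by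
  refine ⟨fun p g => (map_zero (mfderiv 𝓘(ℝ, EP) 𝓘(ℝ, EP) (fun q : P => q <• g) p)).symm,
    fun p v => ?_⟩
  rw [lieD_eq_extD_add hϑ (ContMDiffSection.mdifferentiableAt _)]
  have h3 : mvfderiv 𝓘(ℝ, EP) (fun q => ϑ q ((0 : SmoothVF EP P) q)) p = 0 := by
    have h : (fun q => ϑ q ((0 : SmoothVF EP P) q)) = fun _ => 0 := funext fun q => map_zero (ϑ q)
    rw [h]
    exact mvfderiv_const _
  have h4 : extD ϑ p ((0 : SmoothVF EP P) p) v = 0 := (isLinearMap_extD_left hϑ p v).map_zero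
  rw [h3, h4, smul_zero, zero_add, zero_apply]

theorem lie_mem_setE (hπ : IsSmoothPrincipalBundle EG G EM EP π) (hϑ : SmoothOneForm ϑ)
    {ξ η : SmoothVF EP P} (hξ : ξ ∈ setE G ϑ) (hη : η ∈ setE G ϑ) : ⁅ξ, η⁆ ∈ setE G ϑ := by
  refine ⟨fun p g => ?_, lieD_lie_eq_zero hϑ hξ.2 hη.2⟩
  exact (mfderiv_mlieBracket_of_related (hπ.contMDiff_right g) ξ.mdifferentiableAt
    η.mdifferentiableAt ξ.mdifferentiableAt η.mdifferentiableAt (fun q => (hξ.1 q g).symm)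
    (fun q => (hη.1 q g).symm)).symm

theorem mfderiv_proj_lie (hπ : IsSmoothPrincipalBundle EG G EM EP π) {ξ η : SmoothVF EP P}
    {X Y : SmoothVF EM M} (hX : ∀ p, mfderiv 𝓘(ℝ, EP) 𝓘(ℝ, EM) π p (ξ p) = X (π p))
    (hY : ∀ p, mfderiv 𝓘(ℝ, EP) 𝓘(ℝ, EM) π p (η p) = Y (π p)) (p : P) :
    mfderiv 𝓘(ℝ, EP) 𝓘(ℝ, EM) π p ((⁅ξ, η⁆ : SmoothVF EP P) p) =
      (⁅X, Y⁆ : SmoothVF EM M) (π p) :=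
  mfderiv_mlieBracket_of_related hπ.smooth_proj ξ.mdifferentiableAt
    η.mdifferentiableAt X.mdifferentiableAt Y.mdifferentiableAt hX hY

/-- The vertical component of the bracket on the invariant symmetries of a connection. -/
theorem neg_theta_lie (hπ : IsSmoothPrincipalBundle EG G EM EP π)
    (hT : IsFaithfulSmoothRep EG T) (hϑ : IsConnectionForm (EG := EG) T ϑ) {ξ η : SmoothVF EP P}
    (hξ : ξ ∈ setE G ϑ) (hη : η ∈ setE G ϑ) (p : P) :
    -ϑ p ((⁅ξ, η⁆ : SmoothVF EP P) p) =
      -(2 : ℝ) • curvature EG T ϑ p (ξ p) (η p) + ⁅-ϑ p (ξ p), -ϑ p (η p)⁆ := by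
  set F : P → (V →L[ℂ] V) := fun q => -ϑ q (η q) with hF
  have hFe : F ∈ equivFunctions EG EP P T := neg_theta_mem_equivFunctions hϑ hη.1
  have h1 := lieD_apply hϑ.smooth ξ (η.mdifferentiableAt (x := p))
  rw [hξ.2] at h1
  have h2 : mvfderiv 𝓘(ℝ, EP) F p = -mvfderiv 𝓘(ℝ, EP) (fun q => ϑ q (η q)) p := mvfderiv_fun_neg
  have h3 : -ϑ p ((⁅ξ, η⁆ : SmoothVF EP P) p) = mvfderiv 𝓘(ℝ, EP) F p (ξ p) := by
    rw [h2, neg_apply, sub_eq_zero.1 h1.symm]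
    rfl
  have h4 := map_add (mvfderiv 𝓘(ℝ, EP) F p) (horPart EG T ϑ p (ξ p)) (verPart EG T ϑ p (ξ p))
  rw [horPart_add_verPart] at h4
  -- The symmetry condition for `η` evaluated on `ξ`; exchanging the arguments of `Ω` gives the
  -- minus sign.
  have h5 : mvfderiv 𝓘(ℝ, EP) F p (horPart EG T ϑ p (ξ p)) =
      -(2 : ℝ) • curvature EG T ϑ p (ξ p) (η p) := by
    have h := (mem_setE_iff hπ hT hϑ hη.1).1 hη p (ξ p)
    rw [covDFun] at h
    rw [← h, curvature, curvature, extD_swap, smul_neg, neg_smul]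
  have h6 : mvfderiv 𝓘(ℝ, EP) F p (verPart EG T ϑ p (ξ p)) = ⁅-ϑ p (ξ p), F p⁆ := by
    rw [verPart, vertVec, mvfderiv_orbitDeriv hπ hT hFe, repDeriv_repDerivInv (hϑ.mem_range p _),
      LieRing.of_associative_ring_bracket]
    generalize F p = B
    rw [neg_mul, mul_neg, sub_neg_eq_add, neg_add_eq_sub]
  rw [h3, h4, h5, h6]

theorem exists_lieSubalgebra_setE (hπ : IsSmoothPrincipalBundle EG G EM EP π)
    (hϑ : SmoothOneForm ϑ) :
    ∃ 𝓔 : LieSubalgebra ℝ (SmoothVF EP P), (𝓔 : Set (SmoothVF EP P)) = setE G ϑ :=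
  ⟨{ carrier := setE G ϑ
     add_mem' := add_mem_setE hϑ
     zero_mem' := zero_mem_setE hϑ
     smul_mem' := fun c _ => smul_mem_setE hϑ c
     lie_mem' := lie_mem_setE hπ hϑ }, rfl⟩

theorem exists_lieSubalgebra_setH (hπ : IsSmoothPrincipalBundle EG G EM EP π)
    (hϑ : SmoothOneForm ϑ) :
    ∃ 𝓗 : LieSubalgebra ℝ (SmoothVF EM M), (𝓗 : Set (SmoothVF EM M)) = setH G EM π ϑ :=
  ⟨{ carrier := setH G EM π ϑ
     add_mem' := by
       rintro X Y ⟨ξ, hξ, hX⟩ ⟨η, hη, hY⟩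
       exact ⟨ξ + η, add_mem_setE hϑ hξ hη, fun p =>
         (map_add (mfderiv 𝓘(ℝ, EP) 𝓘(ℝ, EM) π p) (ξ p) (η p)).trans
           (congrArg₂ (· + ·) (hX p) (hY p))⟩
     zero_mem' := ⟨0, zero_mem_setE hϑ, fun p => map_zero (mfderiv 𝓘(ℝ, EP) 𝓘(ℝ, EM) π p)⟩
     smul_mem' := by
       rintro c X ⟨ξ, hξ, hX⟩
       exact ⟨c • ξ, smul_mem_setE hϑ c hξ, fun p =>
         (map_smul (mfderiv 𝓘(ℝ, EP) 𝓘(ℝ, EM) π p) c (ξ p)).trans (congrArg (c • ·) (hX p))⟩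
     lie_mem' := by
       rintro X Y ⟨ξ, hξ, hX⟩ ⟨η, hη, hY⟩
       exact ⟨⁅ξ, η⁆, lie_mem_setE hπ hϑ hξ hη, mfderiv_proj_lie hπ hX hY⟩ }, rfl⟩

theorem lie_mem_equivFunctions (hπ : IsSmoothPrincipalBundle EG G EM EP π)
    (hT : IsFaithfulSmoothRep EG T) {F H : P → (V →L[ℂ] V)} (hF : F ∈ equivFunctions EG EP P T)
    (hH : H ∈ equivFunctions EG EP P T) :
    (fun p => F p * H p - H p * F p) ∈ equivFunctions EG EP P T := by
  have hmul : ContDiff ℝ ∞ (fun x : (V →L[ℂ] V) × (V →L[ℂ] V) => x.1 * x.2) :=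
    contDiff_fst.mul contDiff_snd
  refine ⟨(hmul.contMDiff.comp (hF.1.prodMk_space hH.1)).sub
    (hmul.contMDiff.comp (hH.1.prodMk_space hF.1)), fun p => ?_, fun p g => ?_⟩
  -- The commutator at `p` is the derivative of `F` along the fundamental vector of `a`, where
  -- `DT(e)(a) = H p`, and derivatives of `F` stay in `DT(e)(𝔤)`.
  · obtain ⟨a, ha⟩ := hH.2.1 p
    have h := mvfderiv_mem_range hT hF.1 hF.2.1 p (orbitDeriv EG G EP p a)
    rw [mvfderiv_orbitDeriv hπ hT hF] at h
    exact Eq.mp (congrArg (fun A => F p * A - A * F p ∈ (repDeriv EG T).range) ha) h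
  · have h : ∀ A B : V →L[ℂ] V, ((T g⁻¹ : V →L[ℂ] V) * A * (T g : V →L[ℂ] V)) *
        ((T g⁻¹ : V →L[ℂ] V) * B * (T g : V →L[ℂ] V)) =
        (T g⁻¹ : V →L[ℂ] V) * (A * B) * (T g : V →L[ℂ] V) := fun A B => by
      simp only [mul_assoc]
      rw [← mul_assoc (T g : V →L[ℂ] V) (T g⁻¹ : V →L[ℂ] V), rep_mul_inv_cancel, one_mul]
    beta_reduce
    rw [hF.2.2, hH.2.2, h, h, mul_sub, sub_mul]

theorem exists_lieSubalgebra_setN (hπ : IsSmoothPrincipalBundle EG G EM EP π)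
    (hT : IsFaithfulSmoothRep EG T) :
    ∃ 𝓝 : LieSubalgebra ℝ (P → (V →L[ℂ] V)), (𝓝 : Set (P → (V →L[ℂ] V))) = setN EG T ϑ := by
  have hd : ∀ {F : P → (V →L[ℂ] V)}, F ∈ setN EG T ϑ → ∀ p,
      MDifferentiableAt 𝓘(ℝ, EP) 𝓘(ℝ, V →L[ℂ] V) F p :=
    fun hF p => hF.1.1.mdifferentiable (by simp) p
  refine ⟨{ carrier := setN EG T ϑ
            add_mem' := fun {F H} hF hH => ⟨⟨hF.1.1.add hH.1.1,
              fun p => add_mem (hF.1.2.1 p) (hH.1.2.1 p), fun p g => ?_⟩, fun p v => ?_⟩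
            zero_mem' := ⟨⟨contMDiff_const, fun p => zero_mem _, fun p g => ?_⟩, fun p v => ?_⟩
            smul_mem' := fun c F hF => ⟨⟨(contDiff_const_smul c).contMDiff.comp hF.1.1,
              fun p => Submodule.smul_mem _ c (hF.1.2.1 p), fun p g => ?_⟩, fun p v => ?_⟩
            lie_mem' := fun {F H} hF hH => ⟨lie_mem_equivFunctions hπ hT hF.1 hH.1,
              fun p v => ?_⟩ }, rfl⟩
  · rw [Pi.add_apply, Pi.add_apply, hF.1.2.2, hH.1.2.2, mul_add, add_mul]
  · have h : mvfderiv 𝓘(ℝ, EP) (F + H) p = _ := mvfderiv_add (hd hF p) (hd hH p)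
    have h1 := hF.2 p v
    have h2 := hH.2 p v
    rw [covDFun] at h1 h2 ⊢
    rw [h, add_apply, h1, h2, add_zero]
  · rw [Pi.zero_apply, Pi.zero_apply, mul_zero, zero_mul]
  · rw [covDFun]
    exact DFunLike.congr_fun (mvfderiv_const (0 : V →L[ℂ] V)) _
  · rw [Pi.smul_apply, Pi.smul_apply, hF.1.2.2, mul_smul_comm, smul_mul_assoc]
  · have h1 := hF.2 p v
    rw [covDFun] at h1 ⊢
    exact (DFunLike.congr_fun (const_smul_mfderiv (hd hF p) c) _).trans
      ((congrArg (c • ·) h1).trans (smul_zero c))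
  · have hmd : ∀ {F H : P → (V →L[ℂ] V)}, F ∈ setN EG T ϑ → H ∈ setN EG T ϑ →
        MDifferentiableAt 𝓘(ℝ, EP) 𝓘(ℝ, V →L[ℂ] V) (fun q => F q * H q) p :=
      fun hF hH => ((hd hF p).hasMFDerivAt.mul' (hd hH p).hasMFDerivAt).mdifferentiableAt
    have h : mvfderiv 𝓘(ℝ, EP) (fun q => F q * H q - H q * F q) p = _ :=
      mvfderiv_fun_sub (hmd hF hH) (hmd hH hF)
    have h1 := hF.2 p v
    have h2 := hH.2 p v
    rw [covDFun] at h1 h2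
    refine (DFunLike.congr_fun h (horPart EG T ϑ p v)).trans ?_
    rw [sub_apply, mvfderiv_mul_apply (hd hF p) (hd hH p), mvfderiv_mul_apply (hd hH p) (hd hF p),
      h1, h2]
    simp only [mul_zero, zero_mul, add_zero, sub_zero]

end Symmetries

/-! ### The isomorphism and the exact sequence. -/

theorem proposition3p3
    -- the structure group `G`, a Lie group
    {EG : Type*} [NormedAddCommGroup EG] [NormedSpace ℝ EG] [FiniteDimensional ℝ EG]
    {G : Type*} [TopologicalSpace G] [ChartedSpace EG G] [Group G] [LieGroup 𝓘(ℝ, EG) ∞ G]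
    -- the base manifold `M`
    {EM : Type*} [NormedAddCommGroup EM] [NormedSpace ℝ EM] [FiniteDimensional ℝ EM]
    {M : Type*} [TopologicalSpace M] [ChartedSpace EM M] [IsManifold 𝓘(ℝ, EM) ∞ M]
    -- the total space `P`, with its right action of `G`
    {EP : Type*} [NormedAddCommGroup EP] [NormedSpace ℝ EP] [FiniteDimensional ℝ EP]
    {P : Type*} [TopologicalSpace P] [ChartedSpace EP P] [IsManifold 𝓘(ℝ, EP) ∞ P]
    [MulAction Gᵐᵒᵖ P]
    -- the Hilbert space `V`
    {V : Type*} [NormedAddCommGroup V] [InnerProductSpace ℂ V] [CompleteSpace V]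
    [FiniteDimensional ℂ V]
    (π : P → M) (hπ : IsSmoothPrincipalBundle EG G EM EP π)
    (T : G →* unitary (V →L[ℂ] V)) (hT : IsFaithfulSmoothRep EG T)
    (ϑ : ∀ p : P, TangentSpace 𝓘(ℝ, EP) p →L[ℝ] (V →L[ℂ] V))
    (hϑ : IsConnectionForm (EG := EG) T ϑ) :
    -- `ℰ_G^0`, `ℋ_G^0` and `𝒩_G` are Lie algebras for the commutator brackets
    ∃ (𝓔 : LieSubalgebra ℝ (SmoothVF EP P)) (𝓗 : LieSubalgebra ℝ (SmoothVF EM M))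
      (𝓝 : LieSubalgebra ℝ (P → (V →L[ℂ] V)))
      -- and `ℱ_G^0` is a Lie algebra
      (_ : LieRing (setF EG EM π T ϑ)) (_ : LieAlgebra ℝ (setF EG EM π T ϑ)),
      (𝓔 : Set (SmoothVF EP P)) = setE G ϑ ∧
      (𝓗 : Set (SmoothVF EM M)) = setH G EM π ϑ ∧
      (𝓝 : Set (P → (V →L[ℂ] V))) = setN EG T ϑ ∧
      -- with the vector space structure of pairs
      (∀ a b : setF EG EM π T ϑ, (a + b).1 = a.1 + b.1) ∧
      (∀ (c : ℝ) (a : setF EG EM π T ϑ), (c • a).1 = c • a.1) ∧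
      -- and the bracket `{{(F, X), (G, Y)}} = (-2 Ω(X^*, Y^*) + [F, G], [X, Y])`
      (∀ a b : setF EG EM π T ϑ,
        (∀ p, ⁅a, b⁆.1.1 p =
          -(2 : ℝ) • curvature EG T ϑ p
            (horLift π ϑ p (a.1.2 (π p))) (horLift π ϑ p (b.1.2 (π p)))
          + ⁅a.1.1 p, b.1.1 p⁆) ∧
        ⁅a, b⁆.1.2 = ⁅a.1.2, b.1.2⁆) ∧
      -- the isomorphism `ℰ_G^0 ≅ ℱ_G^0`
      (∃ e : 𝓔 ≃ₗ⁅ℝ⁆ setF EG EM π T ϑ,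
        (∀ (ξ : 𝓔) (p : P),
          (e ξ).1.1 p = -ϑ p (verPart EG T ϑ p (ξ.1 p)) ∧
          (e ξ).1.2 (π p) =
            mfderiv 𝓘(ℝ, EP) 𝓘(ℝ, EM) π p (horPart EG T ϑ p (ξ.1 p))) ∧
        ∀ (a : setF EG EM π T ϑ) (p : P),
          (e.symm a).1 p = horLift π ϑ p (a.1.2 (π p)) - vertVec EG EP T p (a.1.1 p)) ∧
      -- the exact sequence `0 → 𝒩_G → ℱ_G^0 → ℋ_G^0 → 0`
      ∃ (ι₁ : 𝓝 →ₗ⁅ℝ⁆ setF EG EM π T ϑ) (pr₂ : setF EG EM π T ϑ →ₗ⁅ℝ⁆ 𝓗),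
        (∀ F : 𝓝, (ι₁ F).1 = (F.1, 0)) ∧
        (∀ a : setF EG EM π T ϑ, (pr₂ a).1 = a.1.2) ∧
        Function.Injective ι₁ ∧ Function.Exact ι₁ pr₂ ∧ Function.Surjective pr₂ := by
  obtain ⟨𝓔, h𝓔⟩ := exists_lieSubalgebra_setE hπ hϑ.smooth
  obtain ⟨𝓗, h𝓗⟩ := exists_lieSubalgebra_setH hπ hϑ.smooth
  obtain ⟨𝓝, h𝓝⟩ := exists_lieSubalgebra_setN (ϑ := ϑ) hπ hT
  have hE : ∀ ξ : 𝓔, ξ.1 ∈ setE G ϑ := fun ξ => h𝓔 ▸ ξ.2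
  have hN : ∀ F : 𝓝, F.1 ∈ setN EG T ϑ := fun F => h𝓝 ▸ F.2
  -- The chosen `X ξ` is unique since `π` is surjective, so the operations on it can be checked at
  -- points `π p`.
  choose X hX using fun ξ : 𝓔 => exists_mfderiv_proj_eq hπ (hE ξ).1
  let f : 𝓔 → setF EG EM π T ϑ := fun ξ =>
    ⟨((fun p => -ϑ p (ξ.1 p)), X ξ), mk_mem_setF hπ hT hϑ (hE ξ) (hX ξ)⟩
  have hf : Function.Bijective f := by
    refine ⟨fun ξ η h => Subtype.ext (ContMDiffSection.ext fun p => ?_), fun a => ?_⟩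
    · have h' : ((fun p => -ϑ p (ξ.1 p)), X ξ) = ((fun p => -ϑ p (η.1 p)), X η) :=
        congrArg Subtype.val h
      obtain ⟨h1, h2⟩ := Prod.ext_iff.1 h'
      exact eq_of_theta_eq_of_proj_eq hπ hT hϑ (neg_injective (congrFun h1 p))
        ((hX ξ p).trans ((DFunLike.congr_fun h2 (π p)).trans (hX η p).symm))
    · obtain ⟨ζ, hζ, h1, h2⟩ := exists_mem_setE hπ hT hϑ a.2
      have hζ' : ζ ∈ 𝓔 := h𝓔.ge hζ
      exact ⟨⟨ζ, hζ'⟩, Subtype.ext (Prod.ext (funext h1) (eq_of_apply_proj_eq hπ fun p =>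
        (hX ⟨ζ, hζ'⟩ p).symm.trans (h2 p)))⟩
  -- Only `e` being an isomorphism that agrees with `f` is retained; sums, multiples and brackets of
  -- pairs are computed by writing each pair as `e ξ`.
  obtain ⟨iR, iA, e, he⟩ := (Equiv.ofBijective f hf).exists_lieAlgebra (R := ℝ)
  have hs : ∀ a, ∃ ξ, e ξ = a := e.surjective
  have h1 : ∀ (ξ : 𝓔) (p : P), (e ξ).1.1 p = -ϑ p (ξ.1 p) := fun ξ p => by rw [he]; rfl
  have h2 : ∀ (ξ : 𝓔) (p : P),
      mfderiv 𝓘(ℝ, EP) 𝓘(ℝ, EM) π p (ξ.1 p) = (e ξ).1.2 (π p) := fun ξ p => by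
    rw [he]
    exact hX ξ p
  have hadd : ∀ a b : setF EG EM π T ϑ, (a + b).1 = a.1 + b.1 := fun a b => by
    obtain ⟨ξ, rfl⟩ := hs a
    obtain ⟨η, rfl⟩ := hs b
    have h : e ξ + e η = e (ξ + η) := (map_add e.toLinearEquiv ξ η).symm
    rw [h]
    refine Prod.ext (funext fun p => ?_) (eq_of_apply_proj_eq hπ fun p => ?_)
    · refine (h1 _ p).trans (Eq.trans ?_ (congrArg₂ (· + ·) (h1 ξ p) (h1 η p)).symm)
      exact (congrArg Neg.neg (map_add (ϑ p) (ξ.1 p) (η.1 p))).trans (neg_add _ _)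
    · refine (h2 _ p).symm.trans (Eq.trans ?_ (congrArg₂ (· + ·) (h2 ξ p) (h2 η p)))
      exact map_add (mfderiv 𝓘(ℝ, EP) 𝓘(ℝ, EM) π p) (ξ.1 p) (η.1 p)
  have hsmul : ∀ (c : ℝ) (a : setF EG EM π T ϑ), (c • a).1 = c • a.1 := fun c a => by
    obtain ⟨ξ, rfl⟩ := hs a
    have h : c • e ξ = e (c • ξ) := (map_smul e.toLinearEquiv c ξ).symm
    rw [h]
    refine Prod.ext (funext fun p => ?_) (eq_of_apply_proj_eq hπ fun p => ?_)
    · refine (h1 _ p).trans (Eq.trans ?_ (congrArg (c • ·) (h1 ξ p)).symm)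
      exact (congrArg Neg.neg (map_smul (ϑ p) c (ξ.1 p))).trans (smul_neg c _).symm
    · refine (h2 _ p).symm.trans (Eq.trans ?_ (congrArg (c • ·) (h2 ξ p)))
      exact map_smul (mfderiv 𝓘(ℝ, EP) 𝓘(ℝ, EM) π p) c (ξ.1 p)
  have hlie : ∀ a b : setF EG EM π T ϑ,
      (∀ p, ⁅a, b⁆.1.1 p =
        -(2 : ℝ) • curvature EG T ϑ p
          (horLift π ϑ p (a.1.2 (π p))) (horLift π ϑ p (b.1.2 (π p)))
        + ⁅a.1.1 p, b.1.1 p⁆) ∧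
      ⁅a, b⁆.1.2 = ⁅a.1.2, b.1.2⁆ := fun a b => by
    obtain ⟨ξ, rfl⟩ := hs a
    obtain ⟨η, rfl⟩ := hs b
    have h : ⁅e ξ, e η⁆ = e ⁅ξ, η⁆ := (e.map_lie ξ η).symm
    rw [h]
    refine ⟨fun p => ?_, eq_of_apply_proj_eq hπ fun p => ?_⟩
    · rw [h1, h1, h1, curvature_horLift hπ hT hϑ (h2 ξ p), curvature, horPart_horLift hπ hT hϑ,
        horLift_eq_horPart hπ hT hϑ (h2 η p)]
      exact neg_theta_lie hπ hT hϑ (hE ξ) (hE η) p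
    · exact (h2 _ p).symm.trans (mfderiv_proj_lie hπ (h2 ξ) (h2 η) p)
  -- For `X = 0` the condition `X^* ⌟ Ω = 𝐃F` thus reads `𝐃F = 0`, which identifies the kernel of
  -- `pr₂` with `𝒩_G`.
  have hc0 : ∀ p v, curvature EG T ϑ p (horLift π ϑ p ((0 : SmoothVF EM M) (π p))) v = 0 :=
    fun p v => by
      have h : mfderiv 𝓘(ℝ, EP) 𝓘(ℝ, EM) π p 0 = (0 : SmoothVF EM M) (π p) := map_zero _
      rw [curvature_horLift hπ hT hϑ h, curvature, horPart_eq_self hT (map_zero _)]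
      exact (isLinearMap_extD_left hϑ.smooth p _).map_zero
  have hF0 : ∀ F : 𝓝, (F.1, (0 : SmoothVF EM M)) ∈ setF EG EM π T ϑ := fun F => by
    refine ⟨(hN F).1, h𝓗.le (zero_mem 𝓗), fun p v => ?_⟩
    exact ((congrArg ((2 : ℝ) • ·) (hc0 p v)).trans (smul_zero _)).trans ((hN F).2 p v).symm
  let j : 𝓝 → setF EG EM π T ϑ := fun F => ⟨(F.1, 0), hF0 F⟩
  have hjlie : ∀ F H : 𝓝, j ⁅F, H⁆ = ⁅j F, j H⁆ := fun F H => by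
    obtain ⟨hl1, hl2⟩ := hlie (j F) (j H)
    refine Subtype.ext (Prod.ext (funext fun p => ?_) ?_)
    · rw [hl1, show curvature EG T ϑ p (horLift π ϑ p ((j F).1.2 (π p))) _ = 0 from hc0 p _,
        smul_zero, zero_add]
      rfl
    · rw [hl2]
      exact (lie_self (0 : SmoothVF EM M)).symm
  have hjadd : ∀ F H : 𝓝, j (F + H) = j F + j H := fun F H => Subtype.ext (by
    rw [hadd]
    exact Prod.ext rfl (add_zero (0 : SmoothVF EM M)).symm)
  have hjsmul : ∀ (c : ℝ) (F : 𝓝), j (c • F) = c • j F := fun c F => Subtype.ext (by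
    rw [hsmul]
    exact Prod.ext rfl (smul_zero (A := SmoothVF EM M) c).symm)
  let ι₁ : 𝓝 →ₗ⁅ℝ⁆ setF EG EM π T ϑ :=
    { toFun := j
      map_add' := hjadd
      map_smul' := hjsmul
      map_lie' := fun {F H} => hjlie F H }
  let pr₂ : setF EG EM π T ϑ →ₗ⁅ℝ⁆ 𝓗 :=
    { toFun := fun a => ⟨a.1.2, h𝓗.ge a.2.2.1⟩
      map_add' := fun a b => Subtype.ext (congrArg Prod.snd (hadd a b))
      map_smul' := fun c a => Subtype.ext (congrArg Prod.snd (hsmul c a))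
      map_lie' := fun {a b} => Subtype.ext (hlie a b).2 }
  refine ⟨𝓔, 𝓗, 𝓝, iR, iA, h𝓔, h𝓗, h𝓝, hadd, hsmul, hlie, ⟨e, fun ξ p => ⟨?_, ?_⟩, fun a p => ?_⟩,
    ι₁, pr₂, fun _ => rfl, fun _ => rfl, fun F H h => ?_, fun a => ⟨fun h => ?_, ?_⟩, fun Y => ?_⟩
  · rw [h1, theta_verPart hϑ]
  · rw [mfderiv_proj_horPart hπ, h2]
  · obtain ⟨ξ, rfl⟩ := hs a
    rw [e.symm_apply_apply, h1, horLift_eq_horPart hπ hT hϑ (h2 ξ p)]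
    refine eq_of_theta_eq_of_proj_eq hπ hT hϑ ?_ ?_
    · rw [map_sub, theta_horPart hϑ, theta_vertVec hϑ p (neg_mem (hϑ.mem_range p _)), zero_sub,
        neg_neg]
    · rw [map_sub, mfderiv_proj_horPart hπ, mfderiv_proj_vertVec hπ, sub_zero]
  · exact Subtype.ext (congrArg (fun a => a.1.1) h)
  · have hY : a.1.2 = 0 := congrArg Subtype.val h
    have ha : a.1.1 ∈ setN EG T ϑ := by
      refine ⟨a.2.1, fun p v => ?_⟩
      rw [← a.2.2.2 p v, hY]
      exact (congrArg ((2 : ℝ) • ·) (hc0 p v)).trans (smul_zero _)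
    exact ⟨⟨a.1.1, h𝓝.ge ha⟩, Subtype.ext (Prod.ext rfl hY.symm)⟩
  · rintro ⟨F, rfl⟩
    rfl
  · obtain ⟨ξ, hξ, hY⟩ := h𝓗.le Y.2
    exact ⟨e ⟨ξ, h𝓔.ge hξ⟩, Subtype.ext (eq_of_apply_proj_eq hπ fun p =>
      (h2 ⟨ξ, h𝓔.ge hξ⟩ p).symm.trans (hY p))⟩
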